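/- Let $U:\mathbb R\to\mathbb R$ be a double-well potential: a $C^2$ Morse function ($U'(x)=0\Rightarrow U''(x)\neq 0$) whose local minima are exactly $x_0$ and $x_2$ and whose only local maximum is $x_1$, with $x_0<x_1<x_2$, which is convex on $(-\infty,x_0]$ and on $[x_2,\infty)$ and satisfies $U(x)\to\infty$ as $|x|\to\infty$. Assume $U(x_2)<U(x_0)$. For $\varepsilon>0$ let $(X^\varepsilon_s,Y^\varepsilon_s)_{s\ge0}$ be the velocity jump process on $\mathbb R\times\{-1,1\}$ with generator \[Lf(x,y)=y\,\partial_xf(x,y)+\tfrac1\varepsilon\,(yU'(x))_+\,\bigl(f(x,-y)-f(x,y)\bigr)\] started at $(X_0^\varepsilon,Y_0^\varepsilon)=(x_0,-1)$, constructed as follows from independent standard exponential variables $(E_k)_{k\ge0}$: $T_0=0$, \[T_{k+1}=\inf\Bigl\{s>T_k:\ \tfrac1\varepsilon\int_{T_k}^s\bigl(Y_{T_k}^\varepsilon\,U'(X_{T_k}^\varepsilon+Y_{T_k}^\varepsilon(u-T_k))\bigr)_+du\ \ge E_k\Bigr\},\] $X^\varepsilon_s=X^\varepsilon_{T_k}+Y^\varepsilon_{T_k}(s-T_k)$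 for $s\in[T_k,T_{k+1}]$, $Y^\varepsilon_s=Y^\varepsilon_{T_k}$ for $s\in[T_k,T_{k+1})$, and $Y^\varepsilon_{T_{k+1}}=-Y^\varepsilon_{T_k}$. Let $\tau=\inf\{s>0:\ X^\varepsilon_s=x_1\}$. Then $\mathbb E[\tau]<\infty$ for every $\varepsilon>0$, and for every $t>0$, writing $t_\varepsilon=t\,\mathbb E[\tau]$, \[\mathcal W\bigl(\mathcal L(X^\varepsilon_{t_\varepsilon}),\ e^{-t}\delta_{x_0}+(1-e^{-t})\delta_{x_2}\bigr)\ \longrightarrow\ 0\qquad\text{as }\varepsilon\to0^+,\] where $\mathcal W(\nu_1,\nu_2)=\inf_\pi\mathbb E_\pi[|Z_1-Z_2|]$ is the Wasserstein-1 distance, the infimum being over all probability measures $\pi$ on $\mathbb R^2$ with first marginal $\nu_1$ and second marginal $\nu_2$. -/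

import Mathlib

open MeasureTheory ProbabilityTheory Filter Topology

/-- `U` is a double-well potential with local minima `x₀`, `x₂` and local maximum `x₁`:
a Morse function whose local minima are exactly `x₀` and `x₂` and whose only local maximum is
`x₁ ∈ (x₀, x₂)`, convex on each of the two half-lines outside `(x₀, x₂)`, and going to infinity at
infinity. -/
structure IsDoubleWell (U : ℝ → ℝ) (x₀ x₁ x₂ : ℝ) : Prop where
  contDiff : ContDiff ℝ 2 U
  morse : ∀ x, deriv U x = 0 → deriv (deriv U) x ≠ 0
  lt_left : x₀ < x₁
  lt_right : x₁ < x₂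
  isLocalMin_iff : ∀ x, IsLocalMin U x ↔ x = x₀ ∨ x = x₂
  isLocalMax_iff : ∀ x, IsLocalMax U x ↔ x = x₁
  convexOn_left : ConvexOn ℝ (Set.Iic x₀) U
  convexOn_right : ConvexOn ℝ (Set.Ici x₂) U
  tendsto_atBot : Tendsto U atBot atTop
  tendsto_atTop : Tendsto U atTop atTop

namespace VelocityJump

/-- The minimal jump rate `(y U'(x))₊ / ε` at temperature `ε`. -/
noncomputable def rate (U : ℝ → ℝ) (ε x y : ℝ) : ℝ :=
  max (y * deriv U x) 0 / ε

/-- The jump chain `n ↦ (T_n, X_{T_n}, Y_{T_n})` of the process started from `(x, y)` and driven by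
the clocks `e 0, e 1, …`: the `(n+1)`-st jump happens at the first time after `T_n` at which the
jump rate, integrated from `T_n` on along the current straight trajectory, reaches `e n`; the
velocity is then reversed. When `U` goes to infinity at `±∞` and the velocity is `±1`, the set
whose infimum is taken is never empty. -/
noncomputable def chain (U : ℝ → ℝ) (ε x y : ℝ) (e : ℕ → ℝ) : ℕ → ℝ × ℝ × ℝ
  | 0 => (0, x, y)
  | n + 1 =>
    let T := (chain U ε x y e n).1
    let a := (chain U ε x y e n).2.1
    let v := (chain U ε x y e n).2.2
    let T' := sInf {t : ℝ | T < t ∧ e n ≤ ∫ s in T..t, rate U ε (a + v * (s - T)) v}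
    (T', a + v * (T' - T), -v)

/-- The jump times `T_n` (with `T_0 = 0`). -/
noncomputable def jumpTime (U : ℝ → ℝ) (ε x y : ℝ) (e : ℕ → ℝ) (n : ℕ) : ℝ :=
  (chain U ε x y e n).1

open Classical in
/-- The position `X_t` of the process: on `[T_n, T_{n+1})` it equals
`X_{T_n} + Y_{T_n} (t - T_n)`. The last branch concerns only clocks for which infinitely many jumps
accumulate before `t`, and is a convention. -/
noncomputable def position (U : ℝ → ℝ) (ε x y : ℝ) (e : ℕ → ℝ) (t : ℝ) : ℝ :=
  if h : ∃ n, t < jumpTime U ε x y e (n + 1) then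
    let c := chain U ε x y e (Nat.find h)
    c.2.1 + c.2.2 * (t - c.1)
  else x

/-- The first time `inf {t > 0 | X_t = z}` at which the position is `z`, in `[0, ∞]`
(with `inf ∅ = ∞`). -/
noncomputable def hittingTime (U : ℝ → ℝ) (ε x y : ℝ) (e : ℕ → ℝ) (z : ℝ) : ENNReal :=
  ⨅ (t : ℝ) (_ : 0 < t ∧ position U ε x y e t = z), ENNReal.ofReal t

/-- The expectation of the first hitting time of `z`, when the clocks are the random variables
`E 0, E 1, …`. -/
noncomputable def meanHittingTime {Ω : Type*} [MeasurableSpace Ω] (P : Measure Ω)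
    (E : ℕ → Ω → ℝ) (U : ℝ → ℝ) (ε x y z : ℝ) : ENNReal :=
  ∫⁻ ω, hittingTime U ε x y (fun k => E k ω) z ∂P

/-- The law of the position `X_t`, when the clocks are the random variables `E 0, E 1, …`. -/
noncomputable def positionLaw {Ω : Type*} [MeasurableSpace Ω] (P : Measure Ω)
    (E : ℕ → Ω → ℝ) (U : ℝ → ℝ) (ε x y t : ℝ) : Measure ℝ :=
  P.map fun ω => position U ε x y (fun k => E k ω) t

end VelocityJump

/-- The Wasserstein-1 distance `inf_π E_π |Z₁ - Z₂|` between two laws on `ℝ`, the infimum being over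
all probability measures `π` on `ℝ²` with marginals `μ` and `ν`. -/
noncomputable def wassersteinOne (μ ν : Measure ℝ) : ENNReal :=
  ⨅ (π : Measure (ℝ × ℝ)) (_ : IsProbabilityMeasure π ∧ π.fst = μ ∧ π.snd = ν),
    ∫⁻ p, ENNReal.ofReal |p.1 - p.2| ∂π

/-! The particle turns only while climbing, so after each jump it slides down and passes the bottom
of a well before it can turn again. Observed at these passages the process renews itself: from a
bottom `c` the `n`-th leg climbs until the accumulated rise of `U` reaches `ε * e n`, and it changes
well exactly when it faces the barrier and `ε * e n` exceeds `U x₁ - U c`. Velocities alternate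
deterministically, so before the exit every second leg is an attempt to leave the left well, and
each attempt succeeds with probability `p = exp (-(U x₁ - U x₀) / ε)` independently of the past
(`chain_eq`, `measure_stays_even`).

Let `m` be the mean duration of a pair of legs, one leftward and one rightward, from `x₀` with the
rightward one cut at `x₁`. Wald's identity gives `E[τ] + (x₁ - x₀) = m / p`
(`lintegral_hittingTime`). By Chebyshev the first `2k` durations add up to about `k m`; for `k` of
order `1/p` the failure probability is of order `p / ε²`, because `m` is at least a constant times
`ε` (`measure_staySum_deviation_le`, `tendsto_deviation_bound`). So by time `t E[τ]` about `t / p`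
attempts have been possible, and the probability that all fail is about `(1 - p)^(t/p)`, which tends
to `exp (-t)`.

A return from the right well needs a clock with `ε * e n > U x₁ - U x₂`. The expected number of
passages before time `s` is of order `(s + 1) / ε` (`tsum_passTime_mem_le`), so a return before `t
E[τ]` has probability of order `exp (-(U x₀ - U x₂) / ε) / ε`, which vanishes since the right well
is deeper. Hence the probability of being left of `x₁` tends to `exp (-t)`
(`tendsto_measure_position_lt`).

It remains to see that the particle is close to the bottom on its side of `x₁`
(`eventually_lintegral_dist_bottom_le`). The leg in progress at a fixed time is size-biased, but the
same passage count controls the bias. Convexity makes `U` grow linearly, so leg durations are at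
most linear in the clock and have all moments. An explicit coupling (`wassersteinOne_two_points_le`)
bounds the Wasserstein distance by the mean distance to the bottom plus a multiple of the error in
the probability. -/

namespace VelocityJump

/-- The jump rate (at temperature one) integrated along the straight trajectory from `a` with
velocity `v` up to time `r`. -/
noncomputable def energy (U : ℝ → ℝ) (a v r : ℝ) : ℝ :=
  ∫ s in (0 : ℝ)..r, max (v * deriv U (a + v * s)) 0

/-- The first time at which `energy U a v` reaches the level `h`. -/
noncomputable def legTime (U : ℝ → ℝ) (a v h : ℝ) : ℝ :=
  sInf {r : ℝ | 0 < r ∧ h ≤ energy U a v r}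

/-! ### Accumulated jump rate along a straight trajectory, and its inverse -/

section Energy

variable {U : ℝ → ℝ}

theorem continuous_slope (hU : ContDiff ℝ 2 U) (a v : ℝ) :
    Continuous fun s => max (v * deriv U (a + v * s)) 0 := by
  have := hU.continuous_deriv (by norm_num)
  fun_prop

theorem energy_sub (hU : ContDiff ℝ 2 U) (a v r r' : ℝ) :
    energy U a v r' - energy U a v r = ∫ s in r..r', max (v * deriv U (a + v * s)) 0 := by
  have h := continuous_slope hU a v
  rw [energy, energy, intervalIntegral.integral_interval_sub_left] <;>
    exact h.intervalIntegrable _ _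

theorem energy_zero (a v : ℝ) : energy U a v 0 = 0 := by simp [energy]

theorem energy_mono (hU : ContDiff ℝ 2 U) (a v : ℝ) : Monotone (energy U a v) := by
  intro r r' hr
  rw [← sub_nonneg, energy_sub hU]
  exact intervalIntegral.integral_nonneg hr fun _ _ => le_max_right _ _

theorem continuous_energy (hU : ContDiff ℝ 2 U) (a v : ℝ) : Continuous (energy U a v) :=
  intervalIntegral.continuous_primitive (fun _ _ => (continuous_slope hU a v).intervalIntegrable _ _) 0

theorem energy_nonpos (hU : ContDiff ℝ 2 U) (a v : ℝ) {r : ℝ} (hr : r ≤ 0) :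
    energy U a v r ≤ 0 := by
  simpa [energy_zero] using energy_mono hU a v hr

theorem integral_signed_slope (hU : ContDiff ℝ 2 U) {v : ℝ} (a r r' : ℝ) :
    ∫ s in r..r', v * deriv U (a + v * s) = U (a + v * r') - U (a + v * r) := by
  have hc := hU.continuous_deriv (by norm_num)
  have hd := hU.differentiable (by norm_num)
  refine intervalIntegral.integral_eq_sub_of_hasDerivAt (f := fun s => U (a + v * s)) (fun s _ => ?_)
    (Continuous.intervalIntegrable (by fun_prop) _ _)
  have h1 : HasDerivAt (fun s : ℝ => a + v * s) v s := by
    simpa using ((hasDerivAt_id s).const_mul v).const_add a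
  simpa [mul_comm, Function.comp_def] using (hd (a + v * s)).hasDerivAt.comp s h1

theorem sub_le_energy (hU : ContDiff ℝ 2 U) {v : ℝ} (a : ℝ) {r : ℝ} (hr : 0 ≤ r) :
    U (a + v * r) - U a ≤ energy U a v r := by
  have h := integral_signed_slope hU (v := v) a 0 r
  simp only [mul_zero, add_zero] at h
  rw [← h]
  have hc := hU.continuous_deriv (by norm_num)
  exact intervalIntegral.integral_mono_on hr (Continuous.intervalIntegrable (by fun_prop) _ _)
    ((continuous_slope hU a v).intervalIntegrable _ _) fun _ _ => le_max_left _ _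

theorem energy_sub_of_uphill (hU : ContDiff ℝ 2 U) {v : ℝ} (a : ℝ) {r r' : ℝ} (hr : r ≤ r')
    (h : ∀ s ∈ Set.Icc r r', 0 ≤ v * deriv U (a + v * s)) :
    energy U a v r' - energy U a v r = U (a + v * r') - U (a + v * r) := by
  rw [energy_sub hU, ← integral_signed_slope hU]
  refine intervalIntegral.integral_congr fun s hs => ?_
  rw [Set.uIcc_of_le hr] at hs
  exact max_eq_left (h s hs)

theorem energy_sub_of_downhill (hU : ContDiff ℝ 2 U) {v : ℝ} (a : ℝ) {r r' : ℝ} (hr : r ≤ r')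
    (h : ∀ s ∈ Set.Icc r r', v * deriv U (a + v * s) ≤ 0) :
    energy U a v r' = energy U a v r := by
  rw [← sub_eq_zero, energy_sub hU]
  rw [intervalIntegral.integral_congr (g := fun _ => (0 : ℝ))]
  · simp
  · intro s hs
    rw [Set.uIcc_of_le hr] at hs
    exact max_eq_right (h s hs)

theorem energy_add (hU : ContDiff ℝ 2 U) (a v d r : ℝ) :
    energy U a v (d + r) = energy U a v d + energy U (a + v * d) v r := by
  have h := energy_sub hU a v d (d + r)
  have h2 : energy U (a + v * d) v r = ∫ s in d..(d + r), max (v * deriv U (a + v * s)) 0 := by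
    have := intervalIntegral.integral_comp_add_left (a := 0) (b := r)
      (fun s => max (v * deriv U (a + v * s)) 0) d
    rw [add_zero] at this
    rw [← this, energy]
    congr 1; ext s; congr 3; ring
  linarith

/-- Continuity of the energy makes the infimum attained, so `legTime` is a generalized inverse. The
energy is flat on descents, hence no true inverse exists and later arguments go through this
equivalence. -/
theorem legTime_le_iff (hU : ContDiff ℝ 2 U) {a v h : ℝ} (hh : 0 < h)
    (hex : ∃ r, h ≤ energy U a v r) (r : ℝ) :
    legTime U a v h ≤ r ↔ h ≤ energy U a v r := by
  have hpos : ∀ r, h ≤ energy U a v r → 0 < r := fun r hr => by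
    by_contra hn
    linarith [energy_nonpos hU a v (not_lt.1 hn)]
  have hset : {r : ℝ | 0 < r ∧ h ≤ energy U a v r} = {r | h ≤ energy U a v r} := by
    ext r; exact ⟨fun h => h.2, fun h => ⟨hpos r h, h⟩⟩
  have hbdd : BddBelow {r | h ≤ energy U a v r} := ⟨0, fun r hr => (hpos r hr).le⟩
  have hmem : legTime U a v h ∈ {r | h ≤ energy U a v r} := by
    rw [legTime, hset]
    exact (isClosed_le continuous_const (continuous_energy hU a v)).csInf_mem hex hbdd
  constructor
  · intro hr
    exact le_trans hmem (energy_mono hU a v hr)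
  · intro hr
    rw [legTime, hset]
    exact csInf_le hbdd hr

theorem energy_legTime (hU : ContDiff ℝ 2 U) {a v h : ℝ} (hh : 0 < h)
    (hex : ∃ r, h ≤ energy U a v r) : energy U a v (legTime U a v h) = h := by
  refine le_antisymm ?_ ((legTime_le_iff hU hh hex _).1 le_rfl)
  refine le_of_tendsto ((continuous_energy hU a v).continuousWithinAt (s := Set.Iio (legTime U a v h))) ?_
  filter_upwards [self_mem_nhdsWithin] with r hr
  by_contra hn
  exact absurd ((legTime_le_iff hU hh hex r).2 (not_le.1 hn).le) (not_le.2 hr)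

theorem legTime_pos (hU : ContDiff ℝ 2 U) {a v h : ℝ} (hh : 0 < h)
    (hex : ∃ r, h ≤ energy U a v r) : 0 < legTime U a v h := by
  by_contra hn
  have := (legTime_le_iff hU hh hex 0).1 (not_lt.1 hn)
  rw [energy_zero] at this
  linarith

/-- No rate accumulates on a descent, so a leg that starts by sliding down a distance `d` behaves as
if it started afresh at the end of the slide. This is the source of the renewal structure. -/
theorem legTime_downhill (hU : ContDiff ℝ 2 U) {a v h d : ℝ} (hh : 0 < h) (hd : 0 ≤ d)
    (hdown : ∀ s ∈ Set.Icc 0 d, v * deriv U (a + v * s) ≤ 0)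
    (hex : ∃ r, h ≤ energy U (a + v * d) v r) :
    (∃ r, h ≤ energy U a v r) ∧ legTime U a v h = d + legTime U (a + v * d) v h := by
  have h0 : energy U a v d = 0 := by
    rw [energy_sub_of_downhill hU a hd hdown, energy_zero]
  have key : ∀ r, h ≤ energy U a v r ↔ h ≤ energy U (a + v * d) v (r - d) := fun r => by
    have := energy_add hU a v d (r - d)
    rw [h0, add_sub_cancel, zero_add] at this
    rw [this]
  have hex' : ∃ r, h ≤ energy U a v r := by
    obtain ⟨r, hr⟩ := hex
    exact ⟨r + d, (key _).2 (by simpa using hr)⟩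
  refine ⟨hex', eq_of_forall_ge_iff fun r => ?_⟩
  rw [legTime_le_iff hU hh hex', key, ← legTime_le_iff hU hh hex]
  constructor <;> intro h <;> linarith

theorem legTime_mono (hU : ContDiff ℝ 2 U) {a v : ℝ} (hex : ∀ h, ∃ r, h ≤ energy U a v r) :
    Monotone (legTime U a v) := by
  intro h h' hh
  refine csInf_le_csInf ⟨0, fun r hr => hr.1.le⟩ ?_ fun r hr => ⟨hr.1, hh.trans hr.2⟩
  -- The level `1` forces `r > 0` even when `h'` is not positive.
  obtain ⟨r, hr⟩ := hex (max h' 1)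
  refine ⟨r, ?_, (le_max_left _ _).trans hr⟩
  by_contra hn
  have := energy_nonpos hU a v (not_lt.1 hn)
  have := le_max_right h' 1
  linarith

theorem legTime_nonneg (a v h : ℝ) : 0 ≤ legTime U a v h :=
  Real.sInf_nonneg fun _ hr => hr.1.le

/-- One step of the jump chain in terms of `legTime`. -/
theorem sInf_jump (hU : ContDiff ℝ 2 U) {ε a v e : ℝ} (T : ℝ) (hε : 0 < ε) (he : 0 < e)
    (hex : ∃ r, ε * e ≤ energy U a v r) :
    sInf {t : ℝ | T < t ∧ e ≤ ∫ s in T..t, rate U ε (a + v * (s - T)) v}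
      = T + legTime U a v (ε * e) := by
  have hint : ∀ t, ∫ s in T..t, rate U ε (a + v * (s - T)) v = energy U a v (t - T) / ε := by
    intro t
    have := intervalIntegral.integral_comp_sub_right (a := T) (b := t)
      (fun s => rate U ε (a + v * s) v) T
    rw [this, sub_self, energy]
    simp only [rate]
    exact intervalIntegral.integral_div _ _
  have hset : {t : ℝ | T < t ∧ e ≤ ∫ s in T..t, rate U ε (a + v * (s - T)) v}
      = Set.Ici (T + legTime U a v (ε * e)) := by
    ext t
    simp only [Set.mem_ofPred_eq, Set.mem_Ici, hint]
    rw [le_div_iff₀ hε, mul_comm e, ← legTime_le_iff hU (mul_pos hε he) hex]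
    have := legTime_pos hU (mul_pos hε he) hex
    constructor
    · rintro ⟨_, h⟩; linarith
    · intro h; constructor <;> linarith
  rw [hset, csInf_Ici]

end Energy

end VelocityJump

/-! ### Shape of the double well: signs of the slope and linear growth -/

namespace IsDoubleWell

variable {U : ℝ → ℝ} {x₀ x₁ x₂ : ℝ}

theorem continuous_deriv (hU : IsDoubleWell U x₀ x₁ x₂) : Continuous (deriv U) :=
  hU.contDiff.continuous_deriv (by norm_num)

theorem differentiable (hU : IsDoubleWell U x₀ x₁ x₂) : Differentiable ℝ U :=
  hU.contDiff.differentiable (by norm_num)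

/-- By the Morse condition the second derivative test classifies every critical point as a local
minimum or maximum. -/
theorem deriv_eq_zero (hU : IsDoubleWell U x₀ x₁ x₂) {x : ℝ} (hx : deriv U x = 0) :
    x = x₀ ∨ x = x₁ ∨ x = x₂ := by
  have hc := hU.contDiff.continuous.continuousAt (x := x)
  rcases lt_or_gt_of_ne (hU.morse x hx) with h | h
  · exact Or.inr (Or.inl ((hU.isLocalMax_iff x).1 (isLocalMax_of_deriv_deriv_neg h hx hc)))
  · rcases (hU.isLocalMin_iff x).1 (isLocalMin_of_deriv_deriv_pos h hx hc) with h | h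
    · exact Or.inl h
    · exact Or.inr (Or.inr h)

theorem sign_of_preconnected (hU : IsDoubleWell U x₀ x₁ x₂) {s : Set ℝ} (hs : IsPreconnected s)
    (h0 : ∀ x ∈ s, x ≠ x₀ ∧ x ≠ x₁ ∧ x ≠ x₂) :
    (∀ x ∈ s, 0 < deriv U x) ∨ (∀ x ∈ s, deriv U x < 0) := by
  by_contra hcon
  push Not at hcon
  obtain ⟨⟨a, ha, ha'⟩, b, hb, hb'⟩ := hcon
  obtain ⟨c, hc, hc'⟩ := hs.intermediate_value ha hb hU.continuous_deriv.continuousOn ⟨ha', hb'⟩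
  obtain ⟨h1, h2, h3⟩ := h0 c hc
  rcases hU.deriv_eq_zero hc' with h | h | h <;> contradiction

/-- Without critical points the slope has constant sign on the half-line; the wrong sign would keep
`U` below `U x₀` there, against its growth at infinity. The next three lemmas use the same scheme,
with local extremality replacing growth between the wells. -/
theorem deriv_neg_left (hU : IsDoubleWell U x₀ x₁ x₂) : ∀ x < x₀, deriv U x < 0 := by
  have h1 := hU.lt_left
  have h2 := hU.lt_right
  rcases hU.sign_of_preconnected (s := Set.Iio x₀) isPreconnected_Iio
    (fun x (hx : x < x₀) => ⟨hx.ne, (hx.trans h1).ne, (hx.trans (h1.trans h2)).ne⟩) with h | h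
  · exfalso
    have hm : StrictMonoOn U (Set.Iic x₀) := strictMonoOn_of_deriv_pos (convex_Iic x₀)
      hU.contDiff.continuous.continuousOn (by simpa using h)
    obtain ⟨a, ha, ha'⟩ := ((hU.tendsto_atBot.eventually_gt_atTop (U x₀)).and
      (eventually_lt_atBot x₀)).exists
    exact absurd (hm (Set.mem_Iic.2 ha'.le) (Set.mem_Iic.2 le_rfl) ha') (not_lt.2 ha.le)
  · exact h

theorem deriv_pos_right (hU : IsDoubleWell U x₀ x₁ x₂) : ∀ x > x₂, 0 < deriv U x := by
  have h1 := hU.lt_left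
  have h2 := hU.lt_right
  rcases hU.sign_of_preconnected (s := Set.Ioi x₂) isPreconnected_Ioi
    (fun x (hx : x₂ < x) => ⟨((h1.trans h2).trans hx).ne', (h2.trans hx).ne', hx.ne'⟩) with h | h
  · exact h
  · exfalso
    have hm : StrictAntiOn U (Set.Ici x₂) := strictAntiOn_of_deriv_neg (convex_Ici x₂)
      hU.contDiff.continuous.continuousOn (by simpa using h)
    obtain ⟨a, ha, ha'⟩ := ((hU.tendsto_atTop.eventually_gt_atTop (U x₂)).and
      (eventually_gt_atTop x₂)).exists
    exact absurd (hm (Set.mem_Ici.2 le_rfl) (Set.mem_Ici.2 ha'.le) ha') (not_lt.2 ha.le)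

theorem deriv_pos_mid (hU : IsDoubleWell U x₀ x₁ x₂) : ∀ x, x₀ < x → x < x₁ → 0 < deriv U x := by
  have h1 := hU.lt_left
  have h2 := hU.lt_right
  rcases hU.sign_of_preconnected (s := Set.Ioo x₀ x₁) isPreconnected_Ioo
    (fun x hx => ⟨hx.1.ne', hx.2.ne, (hx.2.trans h2).ne⟩) with h | h
  · exact fun x hx hx' => h x ⟨hx, hx'⟩
  · exfalso
    have hm : StrictAntiOn U (Set.Icc x₀ x₁) := strictAntiOn_of_deriv_neg (convex_Icc _ _)
      hU.contDiff.continuous.continuousOn (by simpa using h)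
    have hmin : IsLocalMin U x₀ := (hU.isLocalMin_iff x₀).2 (Or.inl rfl)
    obtain ⟨a, ha, ha'⟩ := ((hmin.filter_mono nhdsWithin_le_nhds : ∀ᶠ x in 𝓝[>] x₀, U x₀ ≤ U x).and
      (Ioo_mem_nhdsGT h1)).exists
    exact absurd (hm ⟨le_rfl, h1.le⟩ ⟨ha'.1.le, ha'.2.le⟩ ha'.1) (not_lt.2 ha)

theorem deriv_neg_mid (hU : IsDoubleWell U x₀ x₁ x₂) : ∀ x, x₁ < x → x < x₂ → deriv U x < 0 := by
  have h1 := hU.lt_left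
  have h2 := hU.lt_right
  rcases hU.sign_of_preconnected (s := Set.Ioo x₁ x₂) isPreconnected_Ioo
    (fun x hx => ⟨(h1.trans hx.1).ne', hx.1.ne', hx.2.ne⟩) with h | h
  · exfalso
    have hm : StrictMonoOn U (Set.Icc x₁ x₂) := strictMonoOn_of_deriv_pos (convex_Icc _ _)
      hU.contDiff.continuous.continuousOn (by simpa using h)
    have hmax : IsLocalMax U x₁ := (hU.isLocalMax_iff x₁).2 rfl
    obtain ⟨a, ha, ha'⟩ := ((hmax.filter_mono nhdsWithin_le_nhds : ∀ᶠ x in 𝓝[>] x₁, U x ≤ U x₁).and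
      (Ioo_mem_nhdsGT h2)).exists
    exact absurd (hm ⟨le_rfl, h2.le⟩ ⟨ha'.1.le, ha'.2.le⟩ ha'.1) (not_lt.2 ha)
  · exact fun x hx hx' => h x ⟨hx, hx'⟩

theorem deriv_zero (hU : IsDoubleWell U x₀ x₁ x₂) :
    deriv U x₀ = 0 ∧ deriv U x₁ = 0 ∧ deriv U x₂ = 0 :=
  ⟨((hU.isLocalMin_iff x₀).2 (Or.inl rfl)).deriv_eq_zero,
    ((hU.isLocalMax_iff x₁).2 rfl).deriv_eq_zero,
    ((hU.isLocalMin_iff x₂).2 (Or.inr rfl)).deriv_eq_zero⟩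

theorem barrier_pos (hU : IsDoubleWell U x₀ x₁ x₂) : U x₀ < U x₁ := by
  have h1 := hU.lt_left
  have hm : StrictMonoOn U (Set.Icc x₀ x₁) := strictMonoOn_of_deriv_pos (convex_Icc _ _)
      hU.contDiff.continuous.continuousOn (by simpa using fun x hx hx' => hU.deriv_pos_mid x hx hx')
  exact hm ⟨le_rfl, h1.le⟩ ⟨h1.le, le_rfl⟩ h1

/-- A function that is convex on a half-line and tends to infinity there grows linearly. -/
theorem _root_.ConvexOn.exists_linear_growth {f : ℝ → ℝ} (hf : ConvexOn ℝ (Set.Ici 0) f)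
    (h : Tendsto f atTop atTop) : ∃ κ > 0, ∃ R, ∀ r ≥ R, κ * r + f 0 ≤ f r := by
  obtain ⟨R, hR, hR'⟩ := ((h.eventually_gt_atTop (f 0)).and (eventually_gt_atTop 0)).exists
  -- The slope of the chord over `[0, R]`, where `f R > f 0`: beyond `R` a convex function stays
  -- above the extended chord.
  refine ⟨(f R - f 0) / R, div_pos (by linarith) hR', R, fun r hr => ?_⟩
  have hr0 : 0 < r := hR'.trans_le hr
  have := hf.2 (Set.mem_Ici.2 le_rfl) (Set.mem_Ici.2 hr0.le) 
    (show 0 ≤ 1 - R / r by rw [sub_nonneg, div_le_one hr0]; exact hr)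
    (show 0 ≤ R / r by positivity) (by ring)
  have e1 : (1 - R / r) • (0 : ℝ) + (R / r) • r = R := by simp; field_simp
  rw [e1, smul_eq_mul, smul_eq_mul] at this
  have h2 : (f R - f 0) / R * r = (f R - f 0) * (r / R) := by ring
  have h3 : (R / r) * (r / R) = 1 := by field_simp
  have h4 : (f R - f 0) * (r / R) ≤ (R / r * (f r - f 0)) * (r / R) := by
    apply mul_le_mul_of_nonneg_right _ (by positivity); linarith
  have h5 : R / r * (f r - f 0) * (r / R) = f r - f 0 := by field_simp
  linarith

/-- Convexity enters the proof only here. Linear growth is what makes the duration of a leg at most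
linear in its clock. -/
theorem exists_linear_growth (hU : IsDoubleWell U x₀ x₁ x₂) :
    ∃ κ > 0, ∃ C, ∀ x, κ * |x| - C ≤ U x := by
  have hl : ConvexOn ℝ (Set.Ici 0) (fun r => U (x₀ - r)) := by
    refine ⟨convex_Ici 0, fun x (hx : 0 ≤ x) y (hy : 0 ≤ y) a b ha hb hab => ?_⟩
    have := hU.convexOn_left.2 (show x₀ - x ∈ Set.Iic x₀ by simpa)
      (show x₀ - y ∈ Set.Iic x₀ by simpa) ha hb hab
    convert this using 2
    simp only [smul_eq_mul]
    linear_combination (-x₀) * hab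
  have hr : ConvexOn ℝ (Set.Ici 0) (fun r => U (x₂ + r)) := by
    refine ⟨convex_Ici 0, fun x (hx : 0 ≤ x) y (hy : 0 ≤ y) a b ha hb hab => ?_⟩
    have := hU.convexOn_right.2 (show x₂ + x ∈ Set.Ici x₂ by simpa)
      (show x₂ + y ∈ Set.Ici x₂ by simpa) ha hb hab
    convert this using 2
    simp only [smul_eq_mul]
    linear_combination (-x₂) * hab
  obtain ⟨κ, hκ, R, hκR⟩ := hl.exists_linear_growth (hU.tendsto_atBot.comp
    (tendsto_atBot_add_const_left atTop x₀ tendsto_neg_atTop_atBot))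
  obtain ⟨κ', hκ', R', hκR'⟩ := hr.exists_linear_growth (hU.tendsto_atTop.comp
    (tendsto_atTop_add_const_left atTop x₂ tendsto_id))
  have hmin : ∃ m, ∀ x ∈ Set.Icc (x₀ - |R|) (x₂ + |R'|), m ≤ U x := by
    have := (isCompact_Icc (a := x₀ - |R|) (b := x₂ + |R'|)).bddBelow_image
      hU.contDiff.continuous.continuousOn
    obtain ⟨m, hm⟩ := this
    exact ⟨m, fun x hx => hm ⟨x, hx, rfl⟩⟩
  obtain ⟨m, hm⟩ := hmin
  set k := min κ κ' with hk
  have hkpos : 0 < k := lt_min hκ hκ'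
  refine ⟨k, hkpos, |m| + k * (|x₀| + |R| + |x₂| + |R'|) + |U x₀| + |U x₂|, fun x => ?_⟩
  have hab : ∀ y : ℝ, 0 ≤ |y| := abs_nonneg
  have n1 : 0 ≤ k * |x₀| := by positivity
  have n2 : 0 ≤ k * |R| := by positivity
  have n3 : 0 ≤ k * |x₂| := by positivity
  have n4 : 0 ≤ k * |R'| := by positivity
  by_cases h1 : x < x₀ - |R|
  · have := hκR (x₀ - x) (by linarith [le_abs_self R])
    simp only [sub_sub_cancel, sub_zero] at this
    have h3 : k * (x₀ - x) ≤ κ * (x₀ - x) :=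
      mul_le_mul_of_nonneg_right (min_le_left _ _) (by linarith [hab R])
    have h4 : |x| ≤ (x₀ - x) + |x₀| := by
      have := abs_sub_abs_le_abs_sub x x₀
      rw [abs_sub_comm, abs_of_nonneg (show 0 ≤ x₀ - x by linarith [hab R])] at this
      linarith
    have h5 := mul_le_mul_of_nonneg_left h4 hkpos.le
    linarith [neg_abs_le (U x₀), hab m, hab (U x₂)]
  by_cases h2 : x₂ + |R'| < x
  · have := hκR' (x - x₂) (by linarith [le_abs_self R'])
    simp only [add_sub_cancel, add_zero] at this
    have h3 : k * (x - x₂) ≤ κ' * (x - x₂) :=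
      mul_le_mul_of_nonneg_right (min_le_right _ _) (by linarith [hab R'])
    have h4 : |x| ≤ (x - x₂) + |x₂| := by
      have := abs_sub_abs_le_abs_sub x x₂
      rw [abs_of_nonneg (show 0 ≤ x - x₂ by linarith [hab R'])] at this
      linarith
    have h5 := mul_le_mul_of_nonneg_left h4 hkpos.le
    linarith [neg_abs_le (U x₂), hab m, hab (U x₀)]
  · push Not at h1 h2
    have := hm x ⟨h1, h2⟩
    have h4 : |x| ≤ |x₀| + |R| + |x₂| + |R'| := abs_le.2
      ⟨by linarith [neg_abs_le x₀, hab x₂, hab R'], by linarith [le_abs_self x₂, hab x₀, hab R]⟩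
    have h5 := mul_le_mul_of_nonneg_left h4 hkpos.le
    linarith [neg_abs_le m, hab (U x₀), hab (U x₂)]

end IsDoubleWell

/-! ### Geometry and duration of a leg from the bottom of a well -/

namespace VelocityJump

/-- The bottom of the well in which a leg through the bottom `c` with velocity `v` ends, when the
jump occurs at the energy level `h`. -/
noncomputable def wellAfter (U : ℝ → ℝ) (x₀ x₁ x₂ c v h : ℝ) : ℝ :=
  if U x₁ - U c < h then (if 0 < v then x₂ else x₀) else c

section Legs

variable {U : ℝ → ℝ} {x₀ x₁ x₂ : ℝ}

/-- The accumulated climb dominates the net gain of height, which grows linearly with the distance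
travelled. -/
theorem exists_le_energy (hU : IsDoubleWell U x₀ x₁ x₂) :
    ∃ κ > 0, ∃ C, ∀ c, (c = x₀ ∨ c = x₂) → ∀ v : ℝ, (v = 1 ∨ v = -1) → ∀ r, 0 ≤ r →
      κ * r - C ≤ energy U c v r := by
  obtain ⟨κ, hκ, C, hC⟩ := hU.exists_linear_growth
  refine ⟨κ, hκ, C + κ * (|x₀| + |x₂|) + |U x₀| + |U x₂|, fun c hc v hv r hr => ?_⟩
  refine le_trans ?_ (sub_le_energy hU.contDiff c hr)
  have h1 := hC (c + v * r)
  have h2 : r - |c| ≤ |c + v * r| := by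
    rcases hv with rfl | rfl
    · linarith [le_abs_self (c + 1 * r), neg_abs_le c]
    · linarith [neg_abs_le (c + -1 * r), le_abs_self c]
  have h3 : |c| ≤ |x₀| + |x₂| := by
    rcases hc with h | h <;> rw [h] <;> linarith [abs_nonneg x₀, abs_nonneg x₂]
  have h4 : U c ≤ |U x₀| + |U x₂| := by
    rcases hc with rfl | rfl
    · linarith [le_abs_self (U c), abs_nonneg (U x₂)]
    · linarith [le_abs_self (U c), abs_nonneg (U x₀)]
  have h5 := mul_le_mul_of_nonneg_left (h2.trans' (sub_le_sub_left h3 r)) hκ.le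
  linarith

theorem exists_energy_ge (hU : IsDoubleWell U x₀ x₁ x₂) {c v : ℝ} (hc : c = x₀ ∨ c = x₂)
    (hv : v = 1 ∨ v = -1) (h : ℝ) : ∃ r, h ≤ energy U c v r := by
  obtain ⟨κ, hκ, C, hC⟩ := exists_le_energy hU
  refine ⟨max ((h + C) / κ) 0, le_trans ?_ (hC c hc v hv _ (le_max_right _ _))⟩
  have : κ * ((h + C) / κ) ≤ κ * max ((h + C) / κ) 0 :=
    mul_le_mul_of_nonneg_left (le_max_left _ _) hκ.le
  rw [mul_div_cancel₀ _ hκ.ne'] at this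
  linarith

theorem measurable_legTime (hU : IsDoubleWell U x₀ x₁ x₂) {c v : ℝ} (hc : c = x₀ ∨ c = x₂)
    (hv : v = 1 ∨ v = -1) : Measurable (legTime U c v) :=
  (legTime_mono hU.contDiff (exists_energy_ge hU hc hv)).measurable

/-- The lower bound holds because the slope is bounded near the wells, so a short leg gathers little
energy; it limits how often passages can occur. The upper bound inverts the linear growth of the
energy; it gives moments. -/
theorem exists_legTime_bounds (hU : IsDoubleWell U x₀ x₁ x₂) :
    ∃ κ > 0, ∃ K > 0, ∀ c, (c = x₀ ∨ c = x₂) → ∀ v : ℝ, (v = 1 ∨ v = -1) → ∀ h > 0,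
      κ * min 1 h ≤ legTime U c v h ∧ legTime U c v h ≤ K * (1 + h) := by
  obtain ⟨k, hk, C, hC⟩ := exists_le_energy hU
  obtain ⟨L, hL⟩ := (isCompact_Icc (a := x₀ - 1) (b := x₂ + 1)).exists_bound_of_continuousOn
    hU.continuous_deriv.continuousOn
  have h1 := hU.lt_left
  have h2 := hU.lt_right
  set M := |L| + 1
  have hM : 1 ≤ M := by simp [M]
  refine ⟨1 / M, by positivity, (|C| + 1) / k, by positivity, fun c hc v hv h hh => ⟨?_, ?_⟩⟩
  · set ℓ := legTime U c v h with hℓ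
    by_cases hle : 1 ≤ ℓ
    · refine le_trans ?_ hle
      calc 1 / M * min 1 h ≤ 1 * 1 :=
            mul_le_mul ((div_le_one (by positivity)).2 hM) (min_le_left _ _)
              (le_min zero_le_one hh.le) zero_le_one
        _ = 1 := one_mul 1
    · push Not at hle
      have h0 : 0 ≤ ℓ := legTime_nonneg _ _ _
      have he : energy U c v ℓ ≤ M * ℓ := by
        have : energy U c v ℓ ≤ ∫ s in (0:ℝ)..ℓ, M := by
          refine intervalIntegral.integral_mono_on h0
            ((continuous_slope hU.contDiff c v).intervalIntegrable _ _) (by simp) fun s hs => ?_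
          have hb := hL (c + v * s) (by
            rcases hv with rfl | rfl <;> rcases hc with rfl | rfl <;> constructor <;>
              linarith [hs.1, hs.2])
          rw [Real.norm_eq_abs] at hb
          have hb' : |deriv U (c + v * s)| ≤ M := by
            simp only [M]; linarith [le_abs_self L]
          refine max_le ?_ (by linarith)
          rcases hv with rfl | rfl
          · linarith [le_abs_self (deriv U (c + 1 * s))]
          · linarith [neg_abs_le (deriv U (c + -1 * s))]
        simpa [mul_comm] using this
      rw [energy_legTime hU.contDiff hh (exists_energy_ge hU hc hv h)] at he
      rw [one_div, inv_mul_le_iff₀ (by positivity)]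
      exact (min_le_right _ _).trans he
  · rw [legTime_le_iff hU.contDiff hh (exists_energy_ge hU hc hv h)]
    refine le_trans ?_ (hC c hc v hv _ (by positivity))
    have : k * ((|C| + 1) / k * (1 + h)) = (|C| + 1) * (1 + h) := by field_simp
    rw [this]
    nlinarith [le_abs_self C, abs_nonneg C, mul_nonneg (abs_nonneg C) hh.le]

/-- Right after leaving a bottom the trajectory climbs strictly, so the energy at distance `δ` is
positive in each of the four cases; `η` is the least of these energies. -/
theorem exists_legTime_le (hU : IsDoubleWell U x₀ x₁ x₂) {δ : ℝ} (hδ : 0 < δ) :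
    ∃ η > 0, ∀ c, (c = x₀ ∨ c = x₂) → ∀ v : ℝ, (v = 1 ∨ v = -1) → ∀ h > 0,
      h ≤ η → legTime U c v h ≤ δ := by
  have h1 := hU.lt_left
  have h2 := hU.lt_right
  have hpos : ∀ c, (c = x₀ ∨ c = x₂) → ∀ v : ℝ, (v = 1 ∨ v = -1) → 0 < energy U c v δ := by
    intro c hc v hv
    by_contra hn
    push Not at hn
    set d := min δ (min (x₁ - x₀) (x₂ - x₁)) / 2 with hd
    have hm : 0 < min δ (min (x₁ - x₀) (x₂ - x₁)) :=
      lt_min hδ (lt_min (by linarith) (by linarith))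
    have hd0 : 0 < d := by positivity
    have hdδ : d < δ := by linarith [min_le_left δ (min (x₁ - x₀) (x₂ - x₁))]
    have hd1 : d < x₁ - x₀ := by
      linarith [(min_le_right δ (min (x₁ - x₀) (x₂ - x₁))).trans (min_le_left _ _)]
    have hd2 : d < x₂ - x₁ := by
      linarith [(min_le_right δ (min (x₁ - x₀) (x₂ - x₁))).trans (min_le_right _ _)]
    have hslope : ∀ s, 0 < s → s ≤ d → 0 < v * deriv U (c + v * s) := by
      intro s hs hs'
      rcases hv with rfl | rfl <;> rcases hc with rfl | rfl
      · linarith [hU.deriv_pos_mid (c + 1 * s) (by linarith) (by linarith)]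
      · linarith [hU.deriv_pos_right (c + 1 * s) (by linarith)]
      · linarith [hU.deriv_neg_left (c + -1 * s) (by linarith)]
      · linarith [hU.deriv_neg_mid (c + -1 * s) (by linarith) (by linarith)]
    have : 0 < energy U c v d := by
      refine intervalIntegral.intervalIntegral_pos_of_pos_on
        ((continuous_slope hU.contDiff c v).intervalIntegrable _ _) (fun s hs => ?_) hd0
      exact lt_of_lt_of_le (hslope s hs.1 hs.2.le) (le_max_left _ _)
    linarith [energy_mono hU.contDiff c v hdδ.le]
  refine ⟨min (min (energy U x₀ 1 δ) (energy U x₀ (-1) δ))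
    (min (energy U x₂ 1 δ) (energy U x₂ (-1) δ)), ?_, fun c hc v hv h hh hle => ?_⟩
  · exact lt_min (lt_min (hpos _ (Or.inl rfl) _ (Or.inl rfl)) (hpos _ (Or.inl rfl) _ (Or.inr rfl)))
      (lt_min (hpos _ (Or.inr rfl) _ (Or.inl rfl)) (hpos _ (Or.inr rfl) _ (Or.inr rfl)))
  · rw [legTime_le_iff hU.contDiff hh (exists_energy_ge hU hc hv h)]
    rw [le_min_iff, le_min_iff, le_min_iff] at hle
    rcases hv with rfl | rfl <;> rcases hc with rfl | rfl
    exacts [hle.1.1, hle.2.1, hle.1.2, hle.2.2]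

/-- Crossing a barrier of height `H` at distance `a`, followed by a descent up to distance `b`. -/
theorem legTime_barrier (hU : ContDiff ℝ 2 U) {c v h a b : ℝ} (ha : 0 ≤ a) (hab : a ≤ b)
    (hup : ∀ s ∈ Set.Icc 0 a, 0 ≤ v * deriv U (c + v * s))
    (hdown : ∀ s ∈ Set.Icc a b, v * deriv U (c + v * s) ≤ 0)
    (hh : 0 < h) (hex : ∃ r, h ≤ energy U c v r) :
    (h < U (c + v * a) - U c → legTime U c v h < a) ∧
    (h ≤ U (c + v * a) - U c → legTime U c v h ≤ a) ∧
    (U (c + v * a) - U c < h → b < legTime U c v h) := by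
  have ea : energy U c v a = U (c + v * a) - U c := by
    have := energy_sub_of_uphill hU c ha hup
    simpa [energy_zero] using this
  refine ⟨fun hlt => ?_, fun hle => ?_, fun hlt => ?_⟩
  · by_contra hn
    have := energy_mono hU c v (not_lt.1 hn)
    rw [energy_legTime hU hh hex] at this
    linarith
  · rwa [legTime_le_iff hU hh hex, ea]
  · by_contra hn
    rw [not_lt, legTime_le_iff hU hh hex, energy_sub_of_downhill hU c hab hdown, ea] at hn
    linarith

theorem uphill_x₀_right (hU : IsDoubleWell U x₀ x₁ x₂) :
    ∀ s ∈ Set.Icc 0 (x₁ - x₀), 0 ≤ (1 : ℝ) * deriv U (x₀ + 1 * s) := by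
  rintro s ⟨hs, hs'⟩
  rw [one_mul, one_mul]
  rcases hs.eq_or_lt with rfl | h
  · rw [add_zero, hU.deriv_zero.1]
  rcases hs'.eq_or_lt with rfl | h'
  · rw [add_sub_cancel, hU.deriv_zero.2.1]
  · exact (hU.deriv_pos_mid _ (by linarith) (by linarith)).le

theorem downhill_x₀_right (hU : IsDoubleWell U x₀ x₁ x₂) :
    ∀ s ∈ Set.Icc (x₁ - x₀) (x₂ - x₀), (1 : ℝ) * deriv U (x₀ + 1 * s) ≤ 0 := by
  rintro s ⟨hs, hs'⟩
  rw [one_mul, one_mul]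
  rcases hs.eq_or_lt with rfl | h
  · rw [add_sub_cancel, hU.deriv_zero.2.1]
  rcases hs'.eq_or_lt with rfl | h'
  · rw [add_sub_cancel, hU.deriv_zero.2.2]
  · exact (hU.deriv_neg_mid _ (by linarith) (by linarith)).le

theorem uphill_x₂_left (hU : IsDoubleWell U x₀ x₁ x₂) :
    ∀ s ∈ Set.Icc 0 (x₂ - x₁), 0 ≤ (-1 : ℝ) * deriv U (x₂ + -1 * s) := by
  rintro s ⟨hs, hs'⟩
  have := downhill_x₀_right hU (x₂ - x₀ - s) ⟨by linarith, by linarith⟩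
  rw [show x₀ + 1 * (x₂ - x₀ - s) = x₂ + -1 * s by ring] at this
  linarith

theorem downhill_x₂_left (hU : IsDoubleWell U x₀ x₁ x₂) :
    ∀ s ∈ Set.Icc (x₂ - x₁) (x₂ - x₀), (-1 : ℝ) * deriv U (x₂ + -1 * s) ≤ 0 := by
  rintro s ⟨hs, hs'⟩
  have := uphill_x₀_right hU (x₂ - x₀ - s) ⟨by linarith, by linarith⟩
  rw [show x₀ + 1 * (x₂ - x₀ - s) = x₂ + -1 * s by ring] at this
  linarith

/-- The last case is a gap: once past `x₁` the leg cannot jump during the descent, so it overshoots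
`x₂`. -/
theorem legTime_x₀_right (hU : IsDoubleWell U x₀ x₁ x₂) {h : ℝ} (hh : 0 < h) :
    (h < U x₁ - U x₀ → legTime U x₀ 1 h < x₁ - x₀) ∧
    (h ≤ U x₁ - U x₀ → legTime U x₀ 1 h ≤ x₁ - x₀) ∧
    (U x₁ - U x₀ < h → x₂ - x₀ < legTime U x₀ 1 h) := by
  have h1 := hU.lt_left
  have h2 := hU.lt_right
  have := legTime_barrier hU.contDiff (by linarith) (by linarith) (uphill_x₀_right hU)
    (downhill_x₀_right hU) hh (exists_energy_ge hU (Or.inl rfl) (Or.inl rfl) h)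
  simpa using this

theorem legTime_x₂_left (hU : IsDoubleWell U x₀ x₁ x₂) {h : ℝ} (hh : 0 < h) :
    (h < U x₁ - U x₂ → legTime U x₂ (-1) h < x₂ - x₁) ∧
    (h ≤ U x₁ - U x₂ → legTime U x₂ (-1) h ≤ x₂ - x₁) ∧
    (U x₁ - U x₂ < h → x₂ - x₀ < legTime U x₂ (-1) h) := by
  have h1 := hU.lt_left
  have h2 := hU.lt_right
  have := legTime_barrier hU.contDiff (by linarith) (by linarith) (uphill_x₂_left hU)
    (downhill_x₂_left hU) hh (exists_energy_ge hU (Or.inr rfl) (Or.inr rfl) h)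
  simpa using this

theorem wellAfter_mem {c v h : ℝ} (hc : c = x₀ ∨ c = x₂) :
    wellAfter U x₀ x₁ x₂ c v h = x₀ ∨ wellAfter U x₀ x₁ x₂ c v h = x₂ := by
  unfold wellAfter
  split_ifs <;> simp [hc]

/-- The geometry of a leg: the bottom of the well in which it ends lies on the trajectory, and from
that bottom on the trajectory goes uphill. -/
theorem leg_geometry (hU : IsDoubleWell U x₀ x₁ x₂) {c v h : ℝ} (hc : c = x₀ ∨ c = x₂)
    (hv : v = 1 ∨ v = -1) (hh : 0 < h) :
    ∃ g, 0 ≤ g ∧ g ≤ legTime U c v h ∧ wellAfter U x₀ x₁ x₂ c v h = c + v * g ∧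
      ∀ s ∈ Set.Icc g (legTime U c v h), 0 ≤ v * deriv U (c + v * s) := by
  have h1 := hU.lt_left
  have h2 := hU.lt_right
  have hright : ∀ x, x₂ ≤ x → 0 ≤ deriv U x := fun x hx => by
    rcases hx.eq_or_lt with rfl | h
    · exact hU.deriv_zero.2.2.ge
    · exact (hU.deriv_pos_right x h).le
  have hleft : ∀ x, x ≤ x₀ → deriv U x ≤ 0 := fun x hx => by
    rcases hx.eq_or_lt with rfl | h
    · exact hU.deriv_zero.1.le
    · exact (hU.deriv_neg_left x h).le
  have hℓ : 0 ≤ legTime U c v h := legTime_nonneg _ _ _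
  rcases hv with rfl | rfl <;> rcases hc with rfl | rfl
  · by_cases hlt : U x₁ - U c < h
    · refine ⟨x₂ - c, by linarith, ((legTime_x₀_right hU hh).2.2 hlt).le, ?_, fun s hs => ?_⟩
      · simp [wellAfter, hlt]
      · linarith [hright (c + 1 * s) (by linarith [hs.1])]
    · refine ⟨0, le_rfl, hℓ, by simp [wellAfter, hlt], fun s hs => ?_⟩
      exact uphill_x₀_right hU s ⟨hs.1, hs.2.trans ((legTime_x₀_right hU hh).2.1 (not_lt.1 hlt))⟩
  · refine ⟨0, le_rfl, hℓ, by simp [wellAfter], fun s hs => ?_⟩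
    linarith [hright (c + 1 * s) (by linarith [hs.1])]
  · refine ⟨0, le_rfl, hℓ, by simp [wellAfter], fun s hs => ?_⟩
    linarith [hleft (c + -1 * s) (by linarith [hs.1])]
  · by_cases hlt : U x₁ - U c < h
    · refine ⟨c - x₀, by linarith, ((legTime_x₂_left hU hh).2.2 hlt).le, ?_, fun s hs => ?_⟩
      · have : ¬ ((0:ℝ) < -1) := by norm_num
        simp [wellAfter, hlt, this]
      · linarith [hleft (c + -1 * s) (by linarith [hs.1])]
    · refine ⟨0, le_rfl, hℓ, by simp [wellAfter, hlt], fun s hs => ?_⟩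
      exact uphill_x₂_left hU s ⟨hs.1, hs.2.trans ((legTime_x₂_left hU hh).2.1 (not_lt.1 hlt))⟩

end Legs

end VelocityJump

/-! ### Pathwise description of the process by its passages through bottoms -/

namespace VelocityJump

/-- The velocity on the `n`-th leg. -/
noncomputable def vel (n : ℕ) : ℝ := (-1) ^ (n + 1)

theorem vel_zero : vel 0 = -1 := by simp [vel]

theorem vel_succ (n : ℕ) : vel (n + 1) = -vel n := by simp [vel, pow_succ]

theorem vel_mem (n : ℕ) : vel n = 1 ∨ vel n = -1 := neg_one_pow_eq_or ℝ (n + 1)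

theorem vel_even (k : ℕ) : vel (2 * k) = -1 := by simp [vel, pow_succ]

theorem vel_odd (k : ℕ) : vel (2 * k + 1) = 1 := by simp [vel, pow_succ]

theorem vel_mul_vel (n : ℕ) : vel n * vel n = 1 := by rcases vel_mem n with h | h <;> simp [h]

/-- The time at which the `n`-th leg passes through the bottom of a well, and that bottom. -/
noncomputable def pass (U : ℝ → ℝ) (ε x₀ x₁ x₂ : ℝ) (e : ℕ → ℝ) : ℕ → ℝ × ℝ
  | 0 => (0, x₀)
  | n + 1 =>
    let c := (pass U ε x₀ x₁ x₂ e n).2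
    let c' := wellAfter U x₀ x₁ x₂ c (vel n) (ε * e n)
    ((pass U ε x₀ x₁ x₂ e n).1 + 2 * legTime U c (vel n) (ε * e n) - |c' - c|, c')

noncomputable def passTime (U : ℝ → ℝ) (ε x₀ x₁ x₂ : ℝ) (e : ℕ → ℝ) (n : ℕ) : ℝ :=
  (pass U ε x₀ x₁ x₂ e n).1

noncomputable def bottom (U : ℝ → ℝ) (ε x₀ x₁ x₂ : ℝ) (e : ℕ → ℝ) (n : ℕ) : ℝ :=
  (pass U ε x₀ x₁ x₂ e n).2

/-- The duration of the part of the `n`-th leg after its passage through a bottom. -/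
noncomputable def climb (U : ℝ → ℝ) (ε x₀ x₁ x₂ : ℝ) (e : ℕ → ℝ) (n : ℕ) : ℝ :=
  legTime U (bottom U ε x₀ x₁ x₂ e n) (vel n) (ε * e n)

/-- The time between two passages through `x₀` when the leg in between has velocity `v` and its jump
occurs at the energy level `h`; legs leaving the well are cut at `x₁`. -/
noncomputable def stayTime (U : ℝ → ℝ) (x₀ x₁ v h : ℝ) : ℝ :=
  if 0 < v then 2 * min (legTime U x₀ 1 h) (x₁ - x₀) else 2 * legTime U x₀ (-1) h

/-- The sum of the first `n` durations `stayTime`. -/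
noncomputable def staySum (U : ℝ → ℝ) (ε x₀ x₁ : ℝ) (e : ℕ → ℝ) (n : ℕ) : ℝ :=
  ∑ i ∈ Finset.range n, stayTime U x₀ x₁ (vel i) (ε * e i)

/-- None of the first `n` legs, if started at the bottom `x₀`, leaves the left well. -/
def Stays (U : ℝ → ℝ) (ε x₀ x₁ : ℝ) (e : ℕ → ℝ) (n : ℕ) : Prop :=
  ∀ i < n, 0 < vel i → ε * e i < U x₁ - U x₀

section Path

variable {U : ℝ → ℝ} {ε x₀ x₁ x₂ : ℝ} {e : ℕ → ℝ}

local notation "ρ" => passTime U ε x₀ x₁ x₂ e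
local notation "β" => bottom U ε x₀ x₁ x₂ e
local notation "ℓ" => climb U ε x₀ x₁ x₂ e
local notation "T" => jumpTime U ε x₀ (-1) e
local notation "X" => position U ε x₀ (-1) e
local notation "S" => staySum U ε x₀ x₁ e

theorem passTime_zero : ρ 0 = 0 := rfl

theorem bottom_zero : β 0 = x₀ := rfl

theorem passTime_succ (n : ℕ) : ρ (n + 1) = ρ n + 2 * ℓ n - |β (n + 1) - β n| := rfl

theorem bottom_succ (n : ℕ) : β (n + 1) = wellAfter U x₀ x₁ x₂ (β n) (vel n) (ε * e n) := rfl

theorem bottom_mem (n : ℕ) : β n = x₀ ∨ β n = x₂ := by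
  induction n with
  | zero => exact Or.inl rfl
  | succ n ih => rw [bottom_succ]; exact wellAfter_mem ih

theorem climb_nonneg (n : ℕ) : 0 ≤ ℓ n := legTime_nonneg _ _ _

theorem exists_mem_passTime {n : ℕ} {s : ℝ} (h0 : 0 ≤ s) (hn : s < ρ n) :
    ∃ i < n, ρ i ≤ s ∧ s < ρ (i + 1) := by
  induction n with
  | zero => rw [passTime_zero] at hn; linarith
  | succ n ih =>
    by_cases h : s < ρ n
    · obtain ⟨i, hi, hi'⟩ := ih h
      exact ⟨i, by omega, hi'⟩
    · exact ⟨n, by omega, not_lt.1 h, hn⟩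

theorem stayTime_nonneg (hU : IsDoubleWell U x₀ x₁ x₂) (v h : ℝ) : 0 ≤ stayTime U x₀ x₁ v h := by
  have := hU.lt_left
  unfold stayTime
  split_ifs
  · have := le_min (legTime_nonneg (U := U) x₀ 1 h) (by linarith : 0 ≤ x₁ - x₀); linarith
  · linarith [legTime_nonneg (U := U) x₀ (-1) h]

theorem exists_exit {n : ℕ} (hne : ∀ n, ε * e n ≠ U x₁ - U x₀) (hF : ¬ Stays U ε x₀ x₁ e n) :
    ∃ N < n, Stays U ε x₀ x₁ e N ∧ 0 < vel N ∧ U x₁ - U x₀ < ε * e N := by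
  induction n with
  | zero => exact absurd (fun i hi => absurd hi (by omega)) hF
  | succ n ih =>
    by_cases h : Stays U ε x₀ x₁ e n
    · refine ⟨n, by omega, h, ?_⟩
      by_contra hn
      refine hF fun i hi hv => ?_
      rcases Nat.lt_succ_iff_lt_or_eq.1 hi with h' | rfl
      · exact h i h' hv
      · rcases lt_or_gt_of_ne (hne i) with h' | h'
        · exact h'
        · exact absurd ⟨hv, h'⟩ hn
    · obtain ⟨N, hN, h⟩ := ih h
      exact ⟨N, by omega, h⟩

theorem staySum_mono (hU : IsDoubleWell U x₀ x₁ x₂) : Monotone S :=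
  monotone_nat_of_le_succ fun n => by
    rw [staySum, staySum, Finset.sum_range_succ]
    linarith [stayTime_nonneg hU (vel n) (ε * e n)]

variable (hU : IsDoubleWell U x₀ x₁ x₂) (hε : 0 < ε) (he : ∀ n, 0 < e n)

include hU hε he

theorem climb_geometry (n : ℕ) :
    ∃ g, 0 ≤ g ∧ g ≤ ℓ n ∧ β (n + 1) = β n + vel n * g ∧ ρ (n + 1) = ρ n + 2 * ℓ n - g ∧
      ∀ s ∈ Set.Icc g (ℓ n), 0 ≤ vel n * deriv U (β n + vel n * s) := by
  obtain ⟨g, h0, h1, h2, h3⟩ := leg_geometry hU (bottom_mem (U := U) (ε := ε) (x₁ := x₁) (e := e) n)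
    (vel_mem n) (mul_pos hε (he n))
  refine ⟨g, h0, h1, h2, ?_, h3⟩
  rw [passTime_succ, bottom_succ, h2, add_sub_cancel_left, abs_mul]
  rcases vel_mem n with h | h <;> simp [h, abs_of_nonneg h0]

theorem passTime_succ_bounds (n : ℕ) : ρ n + ℓ n ≤ ρ (n + 1) ∧ ρ (n + 1) ≤ ρ n + 2 * ℓ n := by
  obtain ⟨g, h0, h1, -, h3, -⟩ := climb_geometry hU hε he n
  constructor <;> linarith

/-- The `n`-th leg starts at a distance `d` before the bottom it is heading for, and slides down to
it. The jump chain and the passage recursion therefore determine each other; the two parts are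
proved together because the jump after leg `n` is found from its start, and the next start from that
jump. -/
theorem chain_eq (n : ℕ) :
    (∃ d, 0 ≤ d ∧ chain U ε x₀ (-1) e n = (ρ n - d, β n - vel n * d, vel n) ∧
      ∀ s ∈ Set.Icc 0 d, vel n * deriv U (β n - vel n * d + vel n * s) ≤ 0) ∧
    chain U ε x₀ (-1) e (n + 1) = (ρ n + ℓ n, β n + vel n * ℓ n, vel (n + 1)) := by
  have step : ∀ n, (∃ d, 0 ≤ d ∧ chain U ε x₀ (-1) e n = (ρ n - d, β n - vel n * d, vel n) ∧
      ∀ s ∈ Set.Icc 0 d, vel n * deriv U (β n - vel n * d + vel n * s) ≤ 0) →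
      chain U ε x₀ (-1) e (n + 1) = (ρ n + ℓ n, β n + vel n * ℓ n, vel (n + 1)) := by
    rintro n ⟨d, hd, hch, hdown⟩
    have hex := exists_energy_ge hU (bottom_mem (U := U) (ε := ε) (x₁ := x₁) (e := e) n)
      (vel_mem n) (ε * e n)
    obtain ⟨hex', hleg⟩ := legTime_downhill hU.contDiff (mul_pos hε (he n)) hd hdown
      (by rwa [sub_add_cancel])
    rw [sub_add_cancel] at hleg
    have hT := sInf_jump hU.contDiff (ρ n - d) hε (he n) hex'
    rw [hleg] at hT
    simp only [chain, hch]
    rw [hT]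
    have hℓ : ℓ n = legTime U (β n) (vel n) (ε * e n) := rfl
    rw [← hℓ, vel_succ]
    ext
    · simp; ring
    · simp; ring
    · rfl
  suffices hd : ∃ d, 0 ≤ d ∧ chain U ε x₀ (-1) e n = (ρ n - d, β n - vel n * d, vel n) ∧
      ∀ s ∈ Set.Icc 0 d, vel n * deriv U (β n - vel n * d + vel n * s) ≤ 0 from ⟨hd, step n hd⟩
  induction n with
  | zero =>
    refine ⟨0, le_rfl, by simp [chain, vel_zero, passTime_zero, bottom_zero], fun s hs => ?_⟩
    obtain rfl : s = 0 := le_antisymm hs.2 hs.1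
    simp [bottom_zero, hU.deriv_zero.1]
  | succ n ih =>
    obtain ⟨g, h0, h1, h2, h3, h4⟩ := climb_geometry hU hε he n
    -- The turn happens at distance `ℓ n` from the old bottom and the new bottom lies at distance
    -- `g` along the leg, so the way back down has length `ℓ n - g`.
    refine ⟨ℓ n - g, by linarith, ?_, fun s hs => ?_⟩
    · rw [step n ih, h2, h3, vel_succ]
      ext
      · simp; ring
      · simp; ring
      · rfl
    · have := h4 (ℓ n - s) ⟨by linarith [hs.2], by linarith [hs.1]⟩
      rw [h2, vel_succ, show β n + vel n * g - -vel n * (ℓ n - g) + -vel n * s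
        = β n + vel n * (ℓ n - s) by ring]
      linarith

theorem jumpTime_succ (n : ℕ) : T (n + 1) = ρ n + ℓ n := by
  rw [jumpTime, (chain_eq hU hε he n).2]

theorem jumpTime_le_passTime (n : ℕ) : T n ≤ ρ n := by
  obtain ⟨⟨d, hd, h, -⟩, -⟩ := chain_eq hU hε he n
  rw [jumpTime, h]
  simpa using hd

theorem monotone_jumpTime : Monotone T := by
  refine monotone_nat_of_le_succ fun n => ?_
  rw [jumpTime_succ hU hε he]
  linarith [jumpTime_le_passTime hU hε he n, climb_nonneg (U := U) (ε := ε) (x₀ := x₀) (x₁ := x₁)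
    (x₂ := x₂) (e := e) n]

theorem monotone_passTime : Monotone ρ := by
  refine monotone_nat_of_le_succ fun n => ?_
  linarith [(passTime_succ_bounds hU hε he n).1, climb_nonneg (U := U) (ε := ε) (x₀ := x₀)
    (x₁ := x₁) (x₂ := x₂) (e := e) n]

theorem position_of_mem {n : ℕ} {s : ℝ} (h1 : T n ≤ s) (h2 : s < T (n + 1)) :
    X s = β n + vel n * (s - ρ n) := by
  classical
  have hex : ∃ n, s < T (n + 1) := ⟨n, h2⟩
  have hfind : Nat.find hex = n := by
    rw [Nat.find_eq_iff]
    refine ⟨h2, fun m hm => not_lt.2 (le_trans ?_ h1)⟩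
    exact monotone_jumpTime hU hε he hm
  obtain ⟨⟨d, hd, h, -⟩, -⟩ := chain_eq hU hε he n
  rw [position, dif_pos hex]
  have : ∀ m, m = n → (chain U ε x₀ (-1) e m).2.1 + (chain U ε x₀ (-1) e m).2.2 *
      (s - (chain U ε x₀ (-1) e m).1) = β n + vel n * (s - ρ n) := by
    rintro m rfl
    rw [h]; simp; ring
  exact this _ (by convert hfind)

theorem position_left {n : ℕ} {s : ℝ} (h1 : ρ n ≤ s) (h2 : s < ρ n + ℓ n) :
    X s = β n + vel n * (s - ρ n) :=
  position_of_mem hU hε he ((jumpTime_le_passTime hU hε he n).trans h1)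
    (by rwa [jumpTime_succ hU hε he])

theorem position_right {n : ℕ} {s : ℝ} (h1 : ρ n + ℓ n ≤ s) (h2 : s < ρ (n + 1)) :
    X s = β (n + 1) + vel (n + 1) * (s - ρ (n + 1)) := by
  refine position_of_mem hU hε he (by rwa [jumpTime_succ hU hε he]) (h2.trans_le ?_)
  rw [jumpTime_succ hU hε he]
  linarith [climb_nonneg (U := U) (ε := ε) (x₀ := x₀) (x₁ := x₁) (x₂ := x₂) (e := e) (n + 1)]

/-- Between two passages `σ` is the distance from the old bottom, first increasing and then
decreasing after the turn. It is bounded by the climb, and on the way back it never falls below the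
distance to the new bottom. -/
theorem position_geometry {n : ℕ} {s : ℝ} (h1 : ρ n ≤ s) (h2 : s < ρ (n + 1)) :
    ∃ σ, 0 ≤ σ ∧ σ ≤ ℓ n ∧ X s = β n + vel n * σ ∧ (s < ρ n + ℓ n → σ = s - ρ n) ∧
      (ρ n + ℓ n ≤ s → vel n * (β (n + 1) - β n) ≤ σ) := by
  by_cases h : s < ρ n + ℓ n
  · exact ⟨s - ρ n, by linarith, by linarith, position_left hU hε he h1 h, fun _ => rfl,
      fun h' => absurd h (not_lt.2 h')⟩
  · obtain ⟨g, g0, g1, g2, g3, -⟩ := climb_geometry hU hε he n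
    have hv := vel_mul_vel n
    refine ⟨g + ρ (n + 1) - s, by linarith, by linarith, ?_, fun h' => absurd h' h, fun _ => ?_⟩
    · rw [position_right hU hε he (not_lt.1 h) h2, g2, vel_succ]; ring
    · rw [g2, add_sub_cancel_left, ← mul_assoc, hv]; linarith

/-- `staySum` is defined from all the clocks, whether or not the particle has left, so that its
summands are independent; up to the first exit it coincides with the true passage time. -/
theorem stays_bottom {n : ℕ} (hF : Stays U ε x₀ x₁ e n) :
    β n = x₀ ∧ ρ n = S n := by
  induction n with
  | zero => exact ⟨rfl, by simp [passTime_zero, staySum]⟩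
  | succ n ih =>
    obtain ⟨hb, hr⟩ := ih fun i hi => hF i (by omega)
    have hb' : β (n + 1) = x₀ := by
      rw [bottom_succ, hb]
      rcases vel_mem n with h | h
      · have := hF n (by omega) (by rw [h]; exact one_pos)
        simp [wellAfter, not_lt.2 this.le]
      · simp [wellAfter, h]
    refine ⟨hb', ?_⟩
    rw [passTime_succ, hb', hb, sub_self, abs_zero, sub_zero, hr, staySum, staySum,
      Finset.sum_range_succ, climb, hb, stayTime]
    congr 1
    rcases vel_mem n with h | h
    · have h3 := hF n (by omega) (by rw [h]; exact one_pos)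
      have h4 := (legTime_x₀_right hU (mul_pos hε (he n))).1 h3
      simp [h, min_eq_left h4.le]
    · simp [h]

theorem position_lt_of_stays {n : ℕ} {s : ℝ} (hF : Stays U ε x₀ x₁ e n) (h0 : 0 ≤ s)
    (hs : s < ρ n) : X s < x₁ := by
  obtain ⟨i, hi, h1, h2⟩ := exists_mem_passTime h0 hs
  obtain ⟨σ, σ0, σ1, hX, -, -⟩ := position_geometry hU hε he h1 h2
  have hb := (stays_bottom hU hε he (n := i) fun j hj => hF j (by omega)).1
  rw [hX, hb]
  rcases vel_mem i with h | h
  · have h4 := (legTime_x₀_right hU (mul_pos hε (he i))).1 (hF i hi (by rw [h]; exact one_pos))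
    rw [climb, hb, h] at σ1
    rw [h]; linarith
  · rw [h]; linarith [hU.lt_left]

theorem bottom_succ_of_exit {N : ℕ} (hF : Stays U ε x₀ x₁ e N) (hv : 0 < vel N)
    (hN : U x₁ - U x₀ < ε * e N) : β (N + 1) = x₂ := by
  rw [bottom_succ, (stays_bottom hU hε he hF).1]
  simp [wellAfter, hv, hN]

/-- The leg that exits is charged a fictitious reflection at `x₁`. The true hitting time is thus
smaller than the sum by `x₁ - x₀`. -/
theorem staySum_succ_of_exit {N : ℕ} (hF : Stays U ε x₀ x₁ e N) (hv : 0 < vel N)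
    (hN : U x₁ - U x₀ < ε * e N) : S (N + 1) = ρ N + 2 * (x₁ - x₀) := by
  rw [(stays_bottom hU hε he hF).2, staySum, Finset.sum_range_succ, ← staySum, stayTime, if_pos hv]
  have := (legTime_x₀_right hU (mul_pos hε (he N))).2.2 hN
  rw [min_eq_right (by linarith [hU.lt_right])]

theorem position_of_exit {N : ℕ} {s : ℝ} (hF : Stays U ε x₀ x₁ e N) (hv : 0 < vel N)
    (hN : U x₁ - U x₀ < ε * e N) (h1 : ρ N ≤ s) (h2 : s < ρ (N + 1)) :
    (s < ρ N + (x₁ - x₀) → X s < x₁) ∧ (s = ρ N + (x₁ - x₀) → X s = x₁) ∧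
      (ρ N + (x₁ - x₀) ≤ s → x₁ ≤ X s) := by
  obtain ⟨σ, σ0, σ1, hX, hl, hr⟩ := position_geometry hU hε he h1 h2
  have hb := (stays_bottom hU hε he hF).1
  have hb' := bottom_succ_of_exit hU hε he hF hv hN
  have hv1 : vel N = 1 := by
    rcases vel_mem N with h | h
    · exact h
    · rw [h] at hv; linarith
  have hlong := (legTime_x₀_right hU (mul_pos hε (he N))).2.2 hN
  have hc : ℓ N = legTime U x₀ 1 (ε * e N) := by rw [climb, hb, hv1]
  rw [← hc] at hlong
  rw [hX, hb, hv1, one_mul]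
  rw [hb, hb', hv1, one_mul] at hr
  have := hU.lt_right
  refine ⟨fun h => ?_, fun h => ?_, fun h => ?_⟩
  · linarith [hl (by linarith)]
  · linarith [hl (by linarith)]
  · by_cases h' : s < ρ N + ℓ N
    · linarith [hl h']
    · linarith [hr (not_lt.1 h')]

/-- Once the exit leg has crossed `x₁`, every later bottom is `x₂` as long as no leftward leg begun
before `s` has a clock above the right barrier, and a leg that respects this barrier turns before
going below `x₁`. -/
theorem le_position_of_exit {n : ℕ} {s : ℝ} (hne : ∀ n, ε * e n ≠ U x₁ - U x₀)
    (hfin : ∃ n, s < ρ n) (hF : ¬ Stays U ε x₀ x₁ e n) (hS : S n ≤ s)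
    (hret : ∀ i, ρ i ≤ s → vel i < 0 → ε * e i ≤ U x₁ - U x₂) : x₁ ≤ X s := by
  obtain ⟨N, hNn, hFN, hv, hN⟩ := exists_exit hne hF
  have hS' : ρ N + 2 * (x₁ - x₀) ≤ s := by
    rw [← staySum_succ_of_exit hU hε he hFN hv hN]
    exact (staySum_mono hU hNn).trans hS
  have hx := hU.lt_left
  have h0 : 0 ≤ s := by
    have : ρ 0 ≤ ρ N := monotone_passTime hU hε he (Nat.zero_le N)
    rw [passTime_zero] at this
    linarith
  obtain ⟨n', hn'⟩ := hfin
  obtain ⟨i, -, h1, h2⟩ := exists_mem_passTime h0 hn'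
  have hNi : N ≤ i := by
    by_contra hlt
    have : ρ (i + 1) ≤ ρ N := monotone_passTime hU hε he (by omega)
    linarith
  rcases hNi.eq_or_lt with rfl | hNi
  · exact (position_of_exit hU hε he hFN hv hN h1 h2).2.2 (by linarith)
  have hb : ∀ j, N + 1 ≤ j → j ≤ i → β j = x₂ := by
    intro j hj
    induction j, hj using Nat.le_induction with
    | base => exact fun _ => bottom_succ_of_exit hU hε he hFN hv hN
    | succ j hj ih =>
      intro hji
      rw [bottom_succ, ih (by omega)]
      rcases vel_mem j with h | h
      · simp [wellAfter, h]
      · have := hret j ((monotone_passTime hU hε he (by omega : j ≤ i)).trans h1) (by rw [h]; simp)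
        simp [wellAfter, not_lt.2 this]
  have hbi := hb i hNi le_rfl
  obtain ⟨σ, σ0, σ1, hX, -, -⟩ := position_geometry hU hε he h1 h2
  rw [hX, hbi]
  rcases vel_mem i with h | h
  · rw [h]; linarith [hU.lt_right]
  · have h4 := (legTime_x₂_left hU (mul_pos hε (he i))).2.1 (hret i h1 (by rw [h]; simp))
    rw [climb, hbi, h] at σ1
    rw [h]; linarith

theorem hittingTime_of_exit {N : ℕ} (hF : Stays U ε x₀ x₁ e N) (hv : 0 < vel N)
    (hN : U x₁ - U x₀ < ε * e N) :
    hittingTime U ε x₀ (-1) e x₁ = ENNReal.ofReal (S (N + 1) - (x₁ - x₀)) := by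
  rw [staySum_succ_of_exit hU hε he hF hv hN, show ρ N + 2 * (x₁ - x₀) - (x₁ - x₀) =
    ρ N + (x₁ - x₀) by ring]
  have h0 : 0 ≤ ρ N := by
    have : ρ 0 ≤ ρ N := monotone_passTime hU hε he (Nat.zero_le N)
    rwa [passTime_zero] at this
  have hx := hU.lt_left
  have hlong : ρ N + (x₁ - x₀) < ρ (N + 1) := by
    have h1 := (legTime_x₀_right hU (mul_pos hε (he N))).2.2 hN
    have hv1 : vel N = 1 := by
      rcases vel_mem N with h | h
      · exact h
      · rw [h] at hv; linarith
    have hc : ℓ N = legTime U x₀ 1 (ε * e N) := by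
      rw [climb, (stays_bottom hU hε he hF).1, hv1]
    have := (passTime_succ_bounds hU hε he N).1
    linarith [hU.lt_right]
  have hX := (position_of_exit hU hε he hF hv hN (by linarith) hlong).2.1 rfl
  refine le_antisymm (iInf₂_le _ ⟨by linarith, hX⟩) (le_iInf₂ fun t ht => ?_)
  · refine ENNReal.ofReal_le_ofReal ?_
    by_contra hlt
    push Not at hlt
    refine ht.2.not_lt ?_
    by_cases h : t < ρ N
    · exact position_lt_of_stays hU hε he hF ht.1.le h
    · exact (position_of_exit hU hε he hF hv hN (not_lt.1 h) (hlt.trans hlong)).1 hlt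

end Path

end VelocityJump

/-! ### The standard exponential law: tails and moments -/

section ExpMeasure

instance isProbabilityMeasure_expMeasure_one : IsProbabilityMeasure (expMeasure 1) :=
  isProbabilityMeasure_expMeasure one_pos

theorem expMeasure_one_eq_withDensity :
    expMeasure 1 = volume.withDensity (exponentialPDF 1) := rfl

theorem expMeasure_one_singleton (x : ℝ) : expMeasure 1 {x} = 0 :=
  withDensity_absolutelyContinuous volume (exponentialPDF 1) Real.volume_singleton

theorem expMeasure_one_Iic {h : ℝ} (hh : 0 ≤ h) :
    expMeasure 1 (Set.Iic h) = ENNReal.ofReal (1 - Real.exp (-h)) := by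
  have := cdf_expMeasure_eq one_pos h
  rw [if_pos hh, one_mul, cdf_eq_real] at this
  rw [← this, ofReal_measureReal]

theorem expMeasure_one_Iio {h : ℝ} (hh : 0 ≤ h) :
    expMeasure 1 (Set.Iio h) = ENNReal.ofReal (1 - Real.exp (-h)) := by
  have : NullSingletonClass (expMeasure 1) := ⟨expMeasure_one_singleton⟩
  rw [← expMeasure_one_Iic hh, measure_congr Iio_ae_eq_Iic]

theorem expMeasure_one_Ioi {h : ℝ} (hh : 0 ≤ h) :
    expMeasure 1 (Set.Ioi h) = ENNReal.ofReal (Real.exp (-h)) := by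
  rw [← Set.compl_Iic, prob_compl_eq_one_sub measurableSet_Iic, expMeasure_one_Iic hh,
    ← ENNReal.ofReal_one, ← ENNReal.ofReal_sub _ (by simpa using hh)]
  congr 1; ring

theorem expMeasure_one_Ici {h : ℝ} (hh : 0 ≤ h) :
    expMeasure 1 (Set.Ici h) = ENNReal.ofReal (Real.exp (-h)) := by
  rw [← Set.compl_Iio, prob_compl_eq_one_sub measurableSet_Iio, expMeasure_one_Iio hh,
    ← ENNReal.ofReal_one, ← ENNReal.ofReal_sub _ (by simpa using hh)]
  congr 1; ring

theorem ae_expMeasure_one_pos : ∀ᵐ x ∂expMeasure 1, 0 < x := by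
  have := expMeasure_one_Iic le_rfl
  simp only [neg_zero, Real.exp_zero, sub_self, ENNReal.ofReal_zero] at this
  rw [ae_iff]
  simpa [not_lt, Set.Iic] using this

theorem lintegral_expMeasure_one_pow_lt_top (k : ℕ) :
    ∫⁻ x, ENNReal.ofReal ((1 + |x|) ^ k) ∂expMeasure 1 < ⊤ := by
  have hm : Measurable (exponentialPDF 1) := by
    unfold exponentialPDF
    exact (measurable_exponentialPDFReal 1).ennreal_ofReal
  rw [expMeasure_one_eq_withDensity, lintegral_withDensity_eq_lintegral_mul _ hm (by fun_prop)]
  -- From `((1 + x) / 2) ^ k / k! ≤ exp ((1 + x) / 2)`: half of the exponential decay absorbs the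
  -- polynomial.
  set C : ℝ := (k.factorial : ℝ) * 2 ^ k * Real.exp (1 / 2)
  have hint : IntegrableOn (fun x : ℝ => C * Real.exp (-(1 / 2) * x)) (Set.Ioi 0) :=
    (exp_neg_integrableOn_Ioi 0 (by norm_num : (0:ℝ) < 1 / 2)).const_mul C
  have hfin : ∫⁻ x in Set.Ioi (0 : ℝ), ENNReal.ofReal (C * Real.exp (-(1 / 2) * x)) < ⊤ :=
    hint.lintegral_lt_top
  refine lt_of_le_of_lt ?_ hfin
  rw [← lintegral_indicator measurableSet_Ioi]
  refine lintegral_mono_ae ?_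
  filter_upwards [show ∀ᵐ x : ℝ, x ≠ 0 by simp [ae_iff]] with x hx0
  by_cases hx : 0 < x
  · rw [Set.indicator_of_mem (by exact hx), Pi.mul_apply, exponentialPDF_of_nonneg hx.le,
      ← ENNReal.ofReal_mul (by positivity)]
    refine ENNReal.ofReal_le_ofReal ?_
    rw [abs_of_pos hx, one_mul, one_mul]
    have h1 := Real.pow_div_factorial_le_exp (x := (1 + x) / 2) (by positivity) k
    rw [div_le_iff₀ (by positivity), div_pow, div_le_iff₀ (by positivity)] at h1
    calc Real.exp (-x) * (1 + x) ^ k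
        ≤ Real.exp (-x) * (Real.exp ((1 + x) / 2) * k.factorial * 2 ^ k) := by gcongr
      _ = C * (Real.exp (-x) * Real.exp (x / 2)) := by
          rw [add_div, Real.exp_add]; simp only [C]; ring
      _ = C * Real.exp (-(1 / 2) * x) := by rw [← Real.exp_add]; congr 2; ring
  · rw [Pi.mul_apply, exponentialPDF_of_neg (lt_of_le_of_ne (not_lt.1 hx) hx0), zero_mul]
    exact zero_le

end ExpMeasure

/-! ### Sequences of independent clocks, and independence from the past -/

namespace VelocityJump

/-- The coordinates are independent standard exponential variables under `μ`. -/
structure IsClockLaw (μ : Measure (ℕ → ℝ)) : Prop where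
  isProb : IsProbabilityMeasure μ
  map_eq : ∀ k, μ.map (fun e => e k) = expMeasure 1
  indep : iIndepFun (fun k (e : ℕ → ℝ) => e k) μ

/-- The σ-algebra of the first `n` clocks. -/
abbrev past (n : ℕ) : MeasurableSpace (ℕ → ℝ) :=
  ⨆ i ∈ {i | i < n}, MeasurableSpace.comap (fun e : ℕ → ℝ => e i) inferInstance

theorem past_le (n : ℕ) : past n ≤ MeasurableSpace.pi :=
  iSup₂_le fun i _ => (measurable_pi_apply i).comap_le

theorem measurable_past {n i : ℕ} (hi : i < n) :
    Measurable[past n] (fun e : ℕ → ℝ => e i) :=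
  measurable_iff_comap_le.2 (le_iSup₂_of_le (f := fun i (_ : i ∈ {i | i < n}) =>
    MeasurableSpace.comap (fun e : ℕ → ℝ => e i) inferInstance) i hi le_rfl)

section Measurability

variable {U : ℝ → ℝ} {ε x₀ x₁ x₂ : ℝ} {Ω : Type*} [MeasurableSpace Ω] {E : Ω → ℕ → ℝ}

theorem measurable_legTime_comp (hU : IsDoubleWell U x₀ x₁ x₂) {v : ℝ} (hv : v = 1 ∨ v = -1)
    {c h : Ω → ℝ} (hc : Measurable c) (hh : Measurable h) (hmem : ∀ ω, c ω = x₀ ∨ c ω = x₂) :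
    Measurable fun ω => legTime U (c ω) v (h ω) := by
  have : (fun ω => legTime U (c ω) v (h ω)) =
      fun ω => if c ω = x₀ then legTime U x₀ v (h ω) else legTime U x₂ v (h ω) := by
    ext ω
    split_ifs with h0
    · rw [h0]
    · rw [(hmem ω).resolve_left h0]
  rw [this]
  exact Measurable.ite (hc (measurableSet_singleton x₀))
    ((measurable_legTime hU (Or.inl rfl) hv).comp hh)
    ((measurable_legTime hU (Or.inr rfl) hv).comp hh)

theorem measurable_wellAfter_comp (hU : IsDoubleWell U x₀ x₁ x₂) (v : ℝ)
    {c h : Ω → ℝ} (hc : Measurable c) (hh : Measurable h) :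
    Measurable fun ω => wellAfter U x₀ x₁ x₂ (c ω) v (h ω) := by
  unfold wellAfter
  exact Measurable.ite (measurableSet_lt (measurable_const.sub
    (hU.contDiff.continuous.measurable.comp hc)) hh) measurable_const hc

theorem measurable_pass (hU : IsDoubleWell U x₀ x₁ x₂) {n : ℕ}
    (hE : ∀ i < n, Measurable fun ω => E ω i) :
    Measurable (fun ω => passTime U ε x₀ x₁ x₂ (E ω) n) ∧
      Measurable fun ω => bottom U ε x₀ x₁ x₂ (E ω) n := by
  induction n with
  | zero => exact ⟨measurable_const, measurable_const⟩
  | succ n ih =>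
    obtain ⟨h1, h2⟩ := ih fun i hi => hE i (by omega)
    have h3 : Measurable fun ω => ε * E ω n := (hE n (by omega)).const_mul ε
    have h4 := measurable_wellAfter_comp hU (vel n) h2 h3
    have h5 := measurable_legTime_comp hU (vel_mem n) h2 h3 fun ω => bottom_mem n
    refine ⟨?_, h4⟩
    have h6 := (h1.add (h5.const_mul 2)).sub (h4.sub h2).abs
    exact h6

theorem measurable_stayTime (hU : IsDoubleWell U x₀ x₁ x₂) (v : ℝ) :
    Measurable (stayTime U x₀ x₁ v) := by
  unfold stayTime
  split_ifs
  · exact ((measurable_legTime hU (Or.inl rfl) (Or.inl rfl)).min measurable_const).const_mul 2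
  · exact (measurable_legTime hU (Or.inl rfl) (Or.inr rfl)).const_mul 2

theorem measurableSet_stays {n : ℕ} (hE : ∀ i < n, Measurable fun ω => E ω i) :
    MeasurableSet {ω | Stays U ε x₀ x₁ (E ω) n} := by
  have : {ω | Stays U ε x₀ x₁ (E ω) n} =
      ⋂ i, ⋂ (_ : i < n), ⋂ (_ : 0 < vel i), {ω | ε * E ω i < U x₁ - U x₀} := by
    ext ω; simp [Stays]
  rw [this]
  exact MeasurableSet.iInter fun i => MeasurableSet.iInter fun hi => MeasurableSet.iInter fun _ =>
    measurableSet_lt ((hE i hi).const_mul ε) measurable_const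

end Measurability

section Clocks

variable {μ : Measure (ℕ → ℝ)} (hμ : IsClockLaw μ)

include hμ

theorem IsClockLaw.ae_apply (n : ℕ) {p : ℝ → Prop} (hp : ∀ᵐ x ∂expMeasure 1, p x) :
    ∀ᵐ e ∂μ, p (e n) := by
  rw [← hμ.map_eq n] at hp
  exact ae_of_ae_map (measurable_pi_apply n).aemeasurable hp

theorem IsClockLaw.ae_pos : ∀ᵐ e ∂μ, ∀ n, 0 < e n :=
  ae_all_iff.2 fun n => hμ.ae_apply n ae_expMeasure_one_pos

theorem IsClockLaw.ae_ne (ε D : ℝ) (hε : 0 < ε) : ∀ᵐ e ∂μ, ∀ n, ε * e n ≠ D := by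
  refine ae_all_iff.2 fun n => hμ.ae_apply n (p := fun x => ε * x ≠ D) ?_
  rw [ae_iff]
  have : {x : ℝ | ¬ ε * x ≠ D} = {D / ε} := by
    ext x; simp [eq_div_iff hε.ne', mul_comm]
  rw [this, expMeasure_one_singleton]

theorem IsClockLaw.indepFun_past {n : ℕ} {Y : (ℕ → ℝ) → ℝ} (hY : Measurable[past n] Y) :
    IndepFun Y (fun e => e n) μ := by
  rw [IndepFun_iff_Indep]
  have h := indep_iSup_of_disjoint (m := fun i : ℕ =>
    MeasurableSpace.comap (fun e : ℕ → ℝ => e i) inferInstance) (μ := μ)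
    (fun i => (measurable_pi_apply i).comap_le) ((iIndepFun_iff_iIndep _ _ _).1 hμ.indep)
    (S := {i | i < n}) (T := {n}) (by simp)
  rw [iSup_singleton] at h
  exact indep_of_indep_of_le_left h (measurable_iff_comap_le.1 hY)

/-- A quantity built from the first `n` clocks can be frozen while integrating over clock `n`, since
their joint law is a product. It is applied to passage times and stay events. -/
theorem IsClockLaw.lintegral_past {n : ℕ} {Y : (ℕ → ℝ) → ℝ} (hY : Measurable[past n] Y)
    {g : ℝ → ℝ → ENNReal} (hg : Measurable (Function.uncurry g)) :
    ∫⁻ e, g (Y e) (e n) ∂μ = ∫⁻ x, ∫⁻ e, g (Y e) x ∂μ ∂expMeasure 1 := by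
  have := hμ.isProb
  have hY' : Measurable Y := hY.mono (past_le n) le_rfl
  have h := (indepFun_iff_map_prod_eq_prod_map_map hY'.aemeasurable
    (measurable_pi_apply n).aemeasurable).1 (hμ.indepFun_past hY)
  have h2 : ∫⁻ e, g (Y e) (e n) ∂μ = ∫⁻ z, Function.uncurry g z ∂(μ.map fun e => (Y e, e n)) := by
    rw [lintegral_map hg (hY'.prodMk (measurable_pi_apply n))]; rfl
  have := (Measure.isProbabilityMeasure_map hY'.aemeasurable : IsProbabilityMeasure (μ.map Y))
  rw [h2, h, hμ.map_eq, lintegral_prod_symm _ hg.aemeasurable]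
  refine lintegral_congr fun x => ?_
  exact lintegral_map (f := fun y => g y x)
    (hg.comp (measurable_id.prodMk measurable_const)) hY'

theorem IsClockLaw.measure_inter_past {n : ℕ} {A : Set (ℕ → ℝ)} (hA : MeasurableSet[past n] A)
    {B : Set ℝ} (hB : MeasurableSet B) : μ (A ∩ {e | e n ∈ B}) = μ A * expMeasure 1 B := by
  have h := hμ.indepFun_past (Y := A.indicator fun _ => 1)
    ((@measurable_const _ _ _ (past n) _).indicator hA)
  have h2 := h.measure_inter_preimage_eq_mul {1} B (measurableSet_singleton _) hB
  have h3 : (A.indicator fun _ => (1 : ℝ)) ⁻¹' {1} = A := by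
    ext e; by_cases he : e ∈ A <;> simp [he]
  rw [h3, ← Measure.map_apply (measurable_pi_apply n) hB, hμ.map_eq] at h2
  exact h2

end Clocks

end VelocityJump

/-! ### Expected number of passages and consequences for the leg in progress -/

namespace VelocityJump

section Renewal

variable {U : ℝ → ℝ} {ε x₀ x₁ x₂ κ : ℝ} {μ : Measure (ℕ → ℝ)}

theorem measurable_passTime_past (hU : IsDoubleWell U x₀ x₁ x₂) (n : ℕ) :
    Measurable[past n] fun e => passTime U ε x₀ x₁ x₂ e n :=
  (@measurable_pass U ε x₀ x₁ x₂ _ (past n) (fun e => e) hU n fun _ hi => measurable_past hi).1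

theorem measurable_passTime (hU : IsDoubleWell U x₀ x₁ x₂) (n : ℕ) :
    Measurable fun e => passTime U ε x₀ x₁ x₂ e n :=
  (measurable_pass (E := fun e => e) hU fun i _ => measurable_pi_apply i).1

theorem measurable_bottom (hU : IsDoubleWell U x₀ x₁ x₂) (n : ℕ) :
    Measurable fun e => bottom U ε x₀ x₁ x₂ e n :=
  (measurable_pass (E := fun e => e) hU fun i _ => measurable_pi_apply i).2

variable (hU : IsDoubleWell U x₀ x₁ x₂) (hε : 0 < ε) (hμ : IsClockLaw μ) (hκ : 0 < κ)
  (hε1 : ε ≤ 1) (hgap : ∀ c, (c = x₀ ∨ c = x₂) → ∀ v : ℝ, (v = 1 ∨ v = -1) → ∀ h > 0,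
      κ * min 1 h ≤ legTime U c v h)

include hU hε hμ hκ hε1 hgap

/-- The expected number of passages in a window of length `κ * ε` is bounded. -/
theorem tsum_window_le (u : ℝ) :
    ∑' n, μ {e | u < passTime U ε x₀ x₁ x₂ e n ∧ passTime U ε x₀ x₁ x₂ e n ≤ u + κ * ε}
      ≤ ENNReal.ofReal (Real.exp 1) := by
  have := hμ.isProb
  set A : ℕ → Set (ℕ → ℝ) := fun n =>
    {e | u < passTime U ε x₀ x₁ x₂ e n ∧ passTime U ε x₀ x₁ x₂ e n ≤ u + κ * ε} with hA
  have hAm : ∀ n, MeasurableSet[past n] (A n) := fun n =>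
    measurable_passTime_past hU n measurableSet_Ioc
  set G : Set (ℕ → ℝ) := {e | ∀ n, 0 < e n}
  have hG : MeasurableSet G := by
    have : G = ⋂ n, {e | 0 < e n} := by ext e; simp [G]
    rw [this]
    exact MeasurableSet.iInter fun n => measurableSet_lt measurable_const (measurable_pi_apply n)
  -- Keep only the passages whose next clock is at least `1`. By independence this costs a factor
  -- `exp (-1)`; positivity of all clocks, an almost sure event, is added so that pathwise estimates
  -- hold everywhere on `B n`.
  set B : ℕ → Set (ℕ → ℝ) := fun n => (A n ∩ {e | e n ∈ Set.Ici 1}) ∩ G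
  have hBm : ∀ n, MeasurableSet (B n) := fun n =>
    ((past_le n _ (hAm n)).inter (measurable_pi_apply n measurableSet_Ici)).inter hG
  have hB : ∀ n, μ (B n) = μ (A n) * ENNReal.ofReal (Real.exp (-1)) := fun n => by
    have h1 : μ (B n) = μ (A n ∩ {e | e n ∈ Set.Ici 1}) :=
      measure_inter_conull' (measure_mono_null (fun e he => he.2) hμ.ae_pos)
    rw [h1, hμ.measure_inter_past (hAm n) measurableSet_Ici, expMeasure_one_Ici zero_le_one]
  -- After such a passage the leg lasts at least `κ * ε`, so the next passage falls beyond the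
  -- window: at most one passage in it can be of this kind.
  have hdisj : Pairwise (Function.onFun Disjoint B) := by
    have key : ∀ m n, m < n → Disjoint (B m) (B n) := by
      intro m n hmn
      rw [Set.disjoint_left]
      rintro e ⟨⟨hm, hm1⟩, hpos⟩ ⟨⟨hn, -⟩, -⟩
      have h1 := (passTime_succ_bounds hU hε hpos m).1
      have h2 : passTime U ε x₀ x₁ x₂ e (m + 1) ≤ passTime U ε x₀ x₁ x₂ e n :=
        monotone_passTime hU hε hpos hmn
      have h3 := hgap _ (bottom_mem (U := U) (ε := ε) (x₀ := x₀) (x₁ := x₁) (x₂ := x₂) (e := e) m)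
        _ (vel_mem m) _ (mul_pos hε (hpos m))
      rw [← climb] at h3
      have h4 : ε ≤ min 1 (ε * e m) :=
        le_min hε1 (le_mul_of_one_le_right hε.le hm1)
      have h5 := mul_le_mul_of_nonneg_left h4 hκ.le
      linarith [hm.1, hn.2]
    intro m n hmn
    rcases lt_or_gt_of_ne hmn with h | h
    · exact key m n h
    · exact (key n m h).symm
  have hsum : (∑' n, μ (A n)) * ENNReal.ofReal (Real.exp (-1)) ≤ 1 := by
    rw [← ENNReal.tsum_mul_right]
    simp_rw [← hB]
    exact (tsum_meas_le_meas_iUnion_of_disjoint μ hBm hdisj).trans prob_le_one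
  rw [Real.exp_neg, ENNReal.ofReal_inv_of_pos (Real.exp_pos 1), ← div_eq_mul_inv] at hsum
  rwa [ENNReal.div_le_iff (by simp [Real.exp_pos]) ENNReal.ofReal_ne_top, one_mul] at hsum

theorem tsum_passTime_mem_le (u : ℝ) {y : ℝ} (hy : 0 ≤ y) :
    ∑' n, μ {e | u - y < passTime U ε x₀ x₁ x₂ e n ∧ passTime U ε x₀ x₁ x₂ e n ≤ u}
      ≤ ENNReal.ofReal ((y / (κ * ε) + 1) * Real.exp 1) := by
  set w := κ * ε with hw
  have hw0 : 0 < w := mul_pos hκ hε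
  -- An interval of length `N * w` is cut into `N` windows of length `w`.
  have key : ∀ N : ℕ, ∑' n, μ {e | u - N * w < passTime U ε x₀ x₁ x₂ e n ∧
      passTime U ε x₀ x₁ x₂ e n ≤ u} ≤ N * ENNReal.ofReal (Real.exp 1) := by
    intro N
    induction N with
    | zero =>
      have : ∀ n, {e | u < passTime U ε x₀ x₁ x₂ e n ∧
          passTime U ε x₀ x₁ x₂ e n ≤ u} = ∅ := fun n =>
        Set.eq_empty_of_forall_notMem fun e he => absurd he.1 (not_lt.2 he.2)
      simp [this]
    | succ N ih =>
      have h := tsum_window_le hU hε hμ hκ hε1 hgap (u - (N + 1 : ℕ) * w)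
      rw [← hw] at h
      calc _ ≤ ∑' n, (μ {e | u - N * w < passTime U ε x₀ x₁ x₂ e n ∧
              passTime U ε x₀ x₁ x₂ e n ≤ u} + μ {e | u - (N + 1 : ℕ) * w <
              passTime U ε x₀ x₁ x₂ e n ∧ passTime U ε x₀ x₁ x₂ e n ≤
                u - (N + 1 : ℕ) * w + w}) := by
            refine ENNReal.tsum_le_tsum fun n => ?_
            refine (measure_mono ?_).trans (measure_union_le _ _)
            rintro e ⟨h1, h2⟩
            by_cases h3 : u - N * w < passTime U ε x₀ x₁ x₂ e n
            · exact Or.inl ⟨h3, h2⟩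
            · refine Or.inr ⟨h1, ?_⟩
              push_cast
              linarith
        _ ≤ N * ENNReal.ofReal (Real.exp 1) + ENNReal.ofReal (Real.exp 1) := by
            rw [ENNReal.tsum_add]
            exact add_le_add ih h
        _ = (N + 1 : ℕ) * ENNReal.ofReal (Real.exp 1) := by push_cast; ring
  have h1 : y ≤ ⌈y / w⌉₊ * w := (div_le_iff₀ hw0).1 (Nat.le_ceil _)
  have h2 : (⌈y / w⌉₊ : ℝ) ≤ y / w + 1 := (Nat.ceil_lt_add_one (by positivity)).le
  calc _ ≤ ∑' n, μ {e | u - ⌈y / w⌉₊ * w < passTime U ε x₀ x₁ x₂ e n ∧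
      passTime U ε x₀ x₁ x₂ e n ≤ u} := by
        refine ENNReal.tsum_le_tsum fun n => measure_mono ?_
        rintro e ⟨h3, h4⟩
        exact ⟨by linarith, h4⟩
    _ ≤ ⌈y / w⌉₊ * ENNReal.ofReal (Real.exp 1) := key _
    _ = ENNReal.ofReal (⌈y / w⌉₊ * Real.exp 1) := by
        rw [ENNReal.ofReal_mul (by positivity), ENNReal.ofReal_natCast]
    _ ≤ _ := ENNReal.ofReal_le_ofReal (by gcongr)

/-- A bound on functionals of the clock of the leg that straddles the time `s`. -/
theorem tsum_lintegral_straddle_le (s : ℝ) {Y : ℝ → ℝ} (hY : Measurable Y) (hY0 : ∀ x, 0 ≤ Y x)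
    {f : ℝ → ENNReal} (hf : Measurable f) :
    ∑' n, ∫⁻ e, (if s - Y (e n) < passTime U ε x₀ x₁ x₂ e n ∧ passTime U ε x₀ x₁ x₂ e n ≤ s
        then f (e n) else 0) ∂μ
      ≤ ∫⁻ x, f x * ENNReal.ofReal ((Y x / (κ * ε) + 1) * Real.exp 1) ∂expMeasure 1 := by
  have h1 : ∀ n, ∫⁻ e, (if s - Y (e n) < passTime U ε x₀ x₁ x₂ e n ∧
      passTime U ε x₀ x₁ x₂ e n ≤ s then f (e n) else 0) ∂μ =
      ∫⁻ x, f x * μ {e | s - Y x < passTime U ε x₀ x₁ x₂ e n ∧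
        passTime U ε x₀ x₁ x₂ e n ≤ s} ∂expMeasure 1 := by
    intro n
    have hset : MeasurableSet {z : ℝ × ℝ | s - Y z.2 < z.1 ∧ z.1 ≤ s} :=
      (measurableSet_lt (measurable_const.sub (hY.comp measurable_snd)) measurable_fst).inter
        (measurableSet_le measurable_fst measurable_const)
    rw [hμ.lintegral_past (measurable_passTime_past hU n)
      (g := fun r x => if s - Y x < r ∧ r ≤ s then f x else 0)
      (Measurable.ite hset (hf.comp measurable_snd) measurable_const)]
    refine lintegral_congr fun x => ?_
    have hm : MeasurableSet {e | s - Y x < passTime U ε x₀ x₁ x₂ e n ∧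
        passTime U ε x₀ x₁ x₂ e n ≤ s} := measurable_passTime hU n measurableSet_Ioc
    rw [← lintegral_indicator_const hm]
    refine lintegral_congr fun e => ?_
    simp [Set.indicator_apply]
  have hmeas : ∀ n, Measurable fun x => f x * μ {e | s - Y x < passTime U ε x₀ x₁ x₂ e n ∧
        passTime U ε x₀ x₁ x₂ e n ≤ s} := by
    intro n
    have := hμ.isProb
    refine hf.mul ?_
    exact measurable_measure_prodMk_left (ν := μ) (s := {z : ℝ × (ℕ → ℝ) |
      s - Y z.1 < passTime U ε x₀ x₁ x₂ z.2 n ∧ passTime U ε x₀ x₁ x₂ z.2 n ≤ s})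
      ((measurableSet_lt (measurable_const.sub (hY.comp measurable_fst))
        ((measurable_passTime hU n).comp measurable_snd)).inter
        (measurableSet_le ((measurable_passTime hU n).comp measurable_snd) measurable_const))
  simp_rw [h1]
  rw [← lintegral_tsum fun n => (hmeas n).aemeasurable]
  refine lintegral_mono fun x => ?_
  simp only
  rw [ENNReal.tsum_mul_left]
  gcongr
  exact tsum_passTime_mem_le hU hε hμ hκ hε1 hgap s (hY0 x)

/-- Almost surely, only finitely many passages occur before the time `s`. -/
theorem ae_exists_lt_passTime (s : ℝ) : ∀ᵐ e ∂μ, ∃ n, s < passTime U ε x₀ x₁ x₂ e n := by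
  -- The interval starts at or below `-1`, hence contains every passage before `s`; finite expected
  -- number and Borel-Cantelli exclude accumulation.
  have h := tsum_passTime_mem_le hU hε hμ hκ hε1 hgap s (y := |s| + 1) (by positivity)
  filter_upwards [ae_eventually_notMem (ne_top_of_le_ne_top ENNReal.ofReal_ne_top h),
    hμ.ae_pos] with e he hpos
  obtain ⟨n, hn⟩ := he.exists
  refine ⟨n, ?_⟩
  by_contra hle
  refine hn ⟨?_, not_lt.1 hle⟩
  have : passTime U ε x₀ x₁ x₂ e 0 ≤ passTime U ε x₀ x₁ x₂ e n :=
    monotone_passTime hU hε hpos (Nat.zero_le n)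
  rw [passTime_zero] at this
  linarith [le_abs_self s]

theorem ae_exists_straddle {s : ℝ} (hs : 0 ≤ s) : ∀ᵐ e ∂μ, ∃ n,
    passTime U ε x₀ x₁ x₂ e n ≤ s ∧ s < passTime U ε x₀ x₁ x₂ e (n + 1) := by
  filter_upwards [ae_exists_lt_passTime hU hε hμ hκ hε1 hgap s] with e he
  obtain ⟨n, hn⟩ := he
  obtain ⟨i, -, hi⟩ := exists_mem_passTime hs hn
  exact ⟨i, hi⟩

/-- On each event that `s` lies between passages `n` and `n + 1` the position is an explicit
measurable function of finitely many clocks, and these events cover almost everything. -/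
theorem aemeasurable_position {s : ℝ} (hs : 0 ≤ s) :
    AEMeasurable (fun e => position U ε x₀ (-1) e s) μ := by
  set A : ℕ → Set (ℕ → ℝ) := fun n => {e | passTime U ε x₀ x₁ x₂ e n ≤ s ∧
    s < passTime U ε x₀ x₁ x₂ e (n + 1)}
  have hA : ∀ n, MeasurableSet (A n) := fun n =>
    (measurableSet_le (measurable_passTime hU n) measurable_const).inter
      (measurableSet_lt measurable_const (measurable_passTime hU (n + 1)))
  have huniv : μ.restrict (⋃ n, A n) = μ := by
    refine Measure.restrict_eq_self_of_ae_mem ?_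
    filter_upwards [ae_exists_straddle hU hε hμ hκ hε1 hgap hs] with e he
    exact Set.mem_iUnion.2 he
  rw [← huniv, aemeasurable_iUnion_iff]
  intro n
  have hρ := measurable_passTime (ε := ε) hU n
  have hρ' := measurable_passTime (ε := ε) hU (n + 1)
  have hβ := measurable_bottom (ε := ε) hU n
  have hβ' := measurable_bottom (ε := ε) hU (n + 1)
  have hh : Measurable fun e : ℕ → ℝ => ε * e n := by fun_prop
  have hℓ : Measurable fun e => climb U ε x₀ x₁ x₂ e n :=
    measurable_legTime_comp hU (vel_mem n) hβ hh fun e => bottom_mem n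
  refine ⟨fun e => if s < passTime U ε x₀ x₁ x₂ e n + climb U ε x₀ x₁ x₂ e n
    then bottom U ε x₀ x₁ x₂ e n + vel n * (s - passTime U ε x₀ x₁ x₂ e n)
    else bottom U ε x₀ x₁ x₂ e (n + 1) + vel (n + 1) * (s - passTime U ε x₀ x₁ x₂ e (n + 1)),
    Measurable.ite (measurableSet_lt measurable_const (hρ.add hℓ)) (by fun_prop) (by fun_prop), ?_⟩
  filter_upwards [ae_restrict_mem (hA n), ae_restrict_of_ae hμ.ae_pos] with e he hpos
  split_ifs with h
  · exact position_left hU hε hpos he.1 h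
  · exact position_right hU hε hpos (not_lt.1 h) he.2

/-- The probability to leave the right well before the time `s`. -/
theorem measure_return_le {s : ℝ} (hs : 0 ≤ s) {D : ℝ} (hD : 0 ≤ D) :
    μ {e | ∃ n, passTime U ε x₀ x₁ x₂ e n ≤ s ∧ D < ε * e n}
      ≤ ENNReal.ofReal (Real.exp (-(D / ε)) * (((s + 1) / (κ * ε) + 1) * Real.exp 1)) := by
  -- The lower bound `s - (s + 1) = -1` is vacuous: the straddle estimate with a constant length `s
  -- + 1` counts all passages before `s`.
  have hm : ∀ n, MeasurableSet {e : ℕ → ℝ | s - (s + 1) < passTime U ε x₀ x₁ x₂ e n ∧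
      passTime U ε x₀ x₁ x₂ e n ≤ s ∧ D / ε < e n} := fun n =>
    (measurableSet_lt measurable_const (measurable_passTime hU n)).inter
      ((measurableSet_le (measurable_passTime hU n) measurable_const).inter
        (measurableSet_lt measurable_const (measurable_pi_apply n)))
  calc _ ≤ μ (⋃ n, {e | s - (s + 1) < passTime U ε x₀ x₁ x₂ e n ∧
        passTime U ε x₀ x₁ x₂ e n ≤ s ∧ D / ε < e n}) := by
        refine measure_mono_ae ?_
        filter_upwards [hμ.ae_pos] with e hpos
        rintro ⟨n, h1, h2⟩
        refine Set.mem_iUnion.2 ⟨n, ?_, h1, by rwa [div_lt_iff₀' hε]⟩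
        have : passTime U ε x₀ x₁ x₂ e 0 ≤ passTime U ε x₀ x₁ x₂ e n :=
          monotone_passTime hU hε hpos (Nat.zero_le n)
        rw [passTime_zero] at this
        linarith
    _ ≤ ∑' n, μ {e | s - (s + 1) < passTime U ε x₀ x₁ x₂ e n ∧
        passTime U ε x₀ x₁ x₂ e n ≤ s ∧ D / ε < e n} := measure_iUnion_le _
    _ = ∑' n, ∫⁻ e, (if s - (s + 1) < passTime U ε x₀ x₁ x₂ e n ∧
        passTime U ε x₀ x₁ x₂ e n ≤ s then (Set.Ioi (D / ε)).indicator 1 (e n) else 0) ∂μ := by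
        congr 1 with n
        rw [← lintegral_indicator_one (hm n)]
        refine lintegral_congr fun e => ?_
        simp only [Set.indicator_apply, Set.mem_ofPred_eq, Set.mem_Ioi, Pi.one_apply]
        split_ifs <;> tauto
    _ ≤ ∫⁻ x, (Set.Ioi (D / ε)).indicator 1 x *
        ENNReal.ofReal (((s + 1) / (κ * ε) + 1) * Real.exp 1) ∂expMeasure 1 :=
        tsum_lintegral_straddle_le hU hε hμ hκ hε1 hgap s (Y := fun _ => s + 1) measurable_const
          (fun _ => by linarith) (measurable_one.indicator measurableSet_Ioi)
    _ = _ := by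
        rw [lintegral_mul_const _ (measurable_one.indicator measurableSet_Ioi),
          lintegral_indicator_one measurableSet_Ioi, expMeasure_one_Ioi (by positivity),
          ENNReal.ofReal_mul (Real.exp_pos _).le]

/-- The expected distance to the bottom of the current well. -/
theorem lintegral_dist_bottom_le {K δ η : ℝ}
    (hK : ∀ c, (c = x₀ ∨ c = x₂) → ∀ v : ℝ, (v = 1 ∨ v = -1) → ∀ h > 0,
      legTime U c v h ≤ K * (1 + h)) (hK0 : x₂ - x₀ ≤ K)
    (hδ0 : δ < x₁ - x₀) (hδ2 : δ < x₂ - x₁)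
    (hη : ∀ c, (c = x₀ ∨ c = x₂) → ∀ v : ℝ, (v = 1 ∨ v = -1) → ∀ h > 0,
      h ≤ η → legTime U c v h ≤ δ) {s : ℝ} (hs : 0 ≤ s) :
    ∫⁻ e, ENNReal.ofReal (if position U ε x₀ (-1) e s < x₁ then |position U ε x₀ (-1) e s - x₀|
        else |position U ε x₀ (-1) e s - x₂|) ∂μ
      ≤ ENNReal.ofReal δ + ∫⁻ x, (if η < ε * x then ENNReal.ofReal (3 * K * (1 + |x|)) else 0) *
        ENNReal.ofReal ((3 * K * (1 + |x|) / (κ * ε) + 1) * Real.exp 1) ∂expMeasure 1 := by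
  have := hμ.isProb
  have hx := hU.lt_left
  have hx2 := hU.lt_right
  have hKpos : 0 < K := by linarith
  have hfm : Measurable fun x : ℝ => (if η < ε * x then ENNReal.ofReal (3 * K * (1 + |x|)) else 0) :=
    Measurable.ite (measurableSet_lt measurable_const (by fun_prop)) (by fun_prop) measurable_const
  -- The leg straddling `s` began less than `2K(1 + e n)` before `s`, and the distance to either
  -- bottom is at most `K(1 + e n) + (x₂ - x₀)`; `3K(1 + |x|)` dominates both, with room to make the
  -- first bound strict.
  refine le_trans ?_ (add_le_add le_rfl (tsum_lintegral_straddle_le hU hε hμ hκ hε1 hgap s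
    (Y := fun x => 3 * K * (1 + |x|)) (by fun_prop) (fun x => by positivity) hfm))
  have hm : ∀ n, Measurable fun e : ℕ → ℝ => (if s - 3 * K * (1 + |e n|) <
      passTime U ε x₀ x₁ x₂ e n ∧ passTime U ε x₀ x₁ x₂ e n ≤ s then
      (if η < ε * e n then ENNReal.ofReal (3 * K * (1 + |e n|)) else 0) else 0) := fun n =>
    Measurable.ite ((measurableSet_lt (by fun_prop) (measurable_passTime hU n)).inter
      (measurableSet_le (measurable_passTime hU n) measurable_const))
      (hfm.comp (measurable_pi_apply n)) measurable_const
  rw [← lintegral_tsum fun n => (hm n).aemeasurable]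
  have hc : ENNReal.ofReal δ = ∫⁻ _, ENNReal.ofReal δ ∂μ := by simp
  rw [hc, ← lintegral_add_left measurable_const]
  refine lintegral_mono_ae ?_
  filter_upwards [hμ.ae_pos, ae_exists_straddle hU hε hμ hκ hε1 hgap hs] with e hpos ⟨n, h1, h2⟩
  obtain ⟨σ, σ0, σ1, hX, -, -⟩ := position_geometry hU hε hpos h1 h2
  have hβ := bottom_mem (U := U) (ε := ε) (x₀ := x₀) (x₁ := x₁) (x₂ := x₂) (e := e) n
  have hh := mul_pos hε (hpos n)
  have hdist : |position U ε x₀ (-1) e s - bottom U ε x₀ x₁ x₂ e n| = σ := by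
    rw [hX, add_sub_cancel_left, abs_mul, abs_of_nonneg σ0]
    rcases vel_mem n with h | h <;> simp [h]
  by_cases hle : ε * e n ≤ η
  · refine le_add_right (ENNReal.ofReal_le_ofReal ?_)
    have hσδ : σ ≤ δ := σ1.trans (hη _ hβ _ (vel_mem n) _ hh hle)
    have habs := abs_le.1 (hdist.le.trans hσδ)
    -- Since `δ` is smaller than both distances to `x₁`, the side of `x₁` on which the particle lies
    -- identifies the current bottom.
    rcases hβ with h | h <;> rw [h] at hdist habs
    · rw [if_pos (by linarith [habs.2]), hdist]; exact hσδ
    · rw [if_neg (by linarith [habs.1]), hdist]; exact hσδ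
  · refine le_add_left (le_trans ?_ (ENNReal.le_tsum n))
    have hσK : σ ≤ K * (1 + e n) := by
      refine (σ1.trans (hK _ hβ _ (vel_mem n) _ hh)).trans ?_
      gcongr
      exact mul_le_of_le_one_left (hpos n).le hε1
    have hr := (passTime_succ_bounds hU hε hpos n).2
    have hcl : climb U ε x₀ x₁ x₂ e n ≤ K * (1 + e n) := by
      refine (hK _ hβ _ (vel_mem n) _ hh).trans ?_
      gcongr
      exact mul_le_of_le_one_left (hpos n).le hε1
    have hKe : K ≤ K * (1 + e n) := by nlinarith [hpos n]
    rw [abs_of_pos (hpos n), 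
      if_pos (show s - 3 * K * (1 + e n) < passTime U ε x₀ x₁ x₂ e n ∧
        passTime U ε x₀ x₁ x₂ e n ≤ s from ⟨by linarith, h1⟩), if_pos (not_le.1 hle)]
    refine ENNReal.ofReal_le_ofReal ?_
    have h3 := abs_le.1 hdist.le
    have : ∀ c, (c = x₀ ∨ c = x₂) →
        |position U ε x₀ (-1) e s - c| ≤ σ + (x₂ - x₀) := by
      intro c hc
      rw [abs_le]
      rcases hc with rfl | rfl <;> rcases hβ with h | h <;> rw [h] at h3 <;>
        constructor <;> linarith
    split_ifs
    · linarith [this x₀ (Or.inl rfl)]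
    · linarith [this x₂ (Or.inr rfl)]

end Renewal

end VelocityJump

/-! ### Exit from the left well: number of attempts, mean and concentration -/

namespace VelocityJump

/-- The mean time between two leftward passages through `x₀` (cut at `x₁`). -/
noncomputable def meanCycle (U : ℝ → ℝ) (ε x₀ x₁ : ℝ) : ℝ :=
  ∫ x, stayTime U x₀ x₁ (-1) (ε * x) ∂expMeasure 1 +
    ∫ x, stayTime U x₀ x₁ 1 (ε * x) ∂expMeasure 1

section Exit

variable {U : ℝ → ℝ} {ε x₀ x₁ x₂ κ K : ℝ} {μ : Measure (ℕ → ℝ)}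

theorem measurableSet_stays_past (n : ℕ) :
    MeasurableSet[past n] {e | Stays U ε x₀ x₁ e n} :=
  @measurableSet_stays U ε x₀ x₁ _ (past n) (fun e => e) n fun _ hi => measurable_past hi

theorem measure_stays_succ (hU : IsDoubleWell U x₀ x₁ x₂) (hε : 0 < ε) (hμ : IsClockLaw μ)
    (n : ℕ) : μ {e | Stays U ε x₀ x₁ e (n + 1)} = μ {e | Stays U ε x₀ x₁ e n} *
      (if 0 < vel n then ENNReal.ofReal (1 - Real.exp (-((U x₁ - U x₀) / ε))) else 1) := by
  have hD : 0 ≤ (U x₁ - U x₀) / ε := div_nonneg (by linarith [hU.barrier_pos]) hε.le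
  split_ifs with h
  · rw [← expMeasure_one_Iio hD,
      ← hμ.measure_inter_past (measurableSet_stays_past n) measurableSet_Iio]
    congr 1
    ext e
    simp only [Stays, Set.mem_inter_iff, Set.mem_ofPred_eq, Set.mem_Iio, lt_div_iff₀' hε]
    constructor
    · exact fun hF => ⟨fun i hi => hF i (by omega), hF n (by omega) h⟩
    · rintro ⟨hF, hn⟩ i hi hv
      rcases Nat.lt_succ_iff_lt_or_eq.1 hi with h' | rfl
      · exact hF i h' hv
      · exact hn
  · rw [mul_one]
    congr 1
    ext e
    simp only [Stays, Set.mem_ofPred_eq]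
    constructor
    · exact fun hF i hi => hF i (by omega)
    · intro hF i hi hv
      rcases Nat.lt_succ_iff_lt_or_eq.1 hi with h' | rfl
      · exact hF i h' hv
      · exact absurd hv h

/-- Leg `2 * k` is leftward and cannot exit, so only one leg of each pair contributes a factor. -/
theorem measure_stays_even (hU : IsDoubleWell U x₀ x₁ x₂) (hε : 0 < ε) (hμ : IsClockLaw μ)
    (k : ℕ) : μ {e | Stays U ε x₀ x₁ e (2 * k)} =
      ENNReal.ofReal (1 - Real.exp (-((U x₁ - U x₀) / ε))) ^ k ∧
      μ {e | Stays U ε x₀ x₁ e (2 * k + 1)} =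
        ENNReal.ofReal (1 - Real.exp (-((U x₁ - U x₀) / ε))) ^ k := by
  have := hμ.isProb
  have hodd : ∀ k, μ {e | Stays U ε x₀ x₁ e (2 * k + 1)} = μ {e | Stays U ε x₀ x₁ e (2 * k)} := by
    intro k
    rw [measure_stays_succ hU hε hμ, vel_even, if_neg (by norm_num), mul_one]
  rw [hodd]
  refine ⟨?_, ?_⟩ <;>
  · induction k with
    | zero =>
      have : {e | Stays U ε x₀ x₁ e (2 * 0)} = Set.univ := by ext e; simp [Stays]
      rw [this, measure_univ, pow_zero]
    | succ k ih =>
      rw [show 2 * (k + 1) = (2 * k + 1) + 1 by ring, measure_stays_succ hU hε hμ, hodd, ih, vel_odd,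
        if_pos one_pos, pow_succ]

theorem exp_barrier_mem (hU : IsDoubleWell U x₀ x₁ x₂) (hε : 0 < ε) :
    0 < Real.exp (-((U x₁ - U x₀) / ε)) ∧ Real.exp (-((U x₁ - U x₀) / ε)) < 1 := by
  refine ⟨Real.exp_pos _, ?_⟩
  rw [Real.exp_lt_one_iff]
  have := div_pos (sub_pos.2 hU.barrier_pos) hε
  linarith

theorem ae_exists_not_stays (hU : IsDoubleWell U x₀ x₁ x₂) (hε : 0 < ε) (hμ : IsClockLaw μ) :
    ∀ᵐ e ∂μ, ∃ n, ¬ Stays U ε x₀ x₁ e n := by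
  obtain ⟨hp, hp1⟩ := exp_barrier_mem hU hε
  rw [ae_iff]
  push Not
  set r := ENNReal.ofReal (1 - Real.exp (-((U x₁ - U x₀) / ε)))
  have hr : r < 1 := by
    rw [← ENNReal.ofReal_one]
    exact (ENNReal.ofReal_lt_ofReal_iff one_pos).2 (by linarith)
  refine le_antisymm (ge_of_tendsto' (ENNReal.tendsto_pow_atTop_nhds_zero_of_lt_one hr) fun k => ?_)
    zero_le
  rw [← (measure_stays_even hU hε hμ k).1]
  exact measure_mono fun e he => he _

theorem measurable_ofReal_stayTime (hU : IsDoubleWell U x₀ x₁ x₂) (v : ℝ) :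
    Measurable fun x => ENNReal.ofReal (stayTime U x₀ x₁ v (ε * x)) :=
  ((measurable_stayTime hU v).comp (by fun_prop)).ennreal_ofReal

theorem measurable_indicator_stays_mul (hU : IsDoubleWell U x₀ x₁ x₂) (n : ℕ) :
    Measurable fun e => {e | Stays U ε x₀ x₁ e n}.indicator (fun _ => (1 : ENNReal)) e *
      ENNReal.ofReal (stayTime U x₀ x₁ (vel n) (ε * e n)) :=
  (measurable_const.indicator (past_le n _ (measurableSet_stays_past n))).mul
    ((measurable_ofReal_stayTime hU (vel n)).comp (measurable_pi_apply n))

/-- Leg `n` is counted when all earlier ones stayed, so the exit leg itself is included with its cut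
duration. The weight of leg `n` then depends only on the past of clock `n`, as Wald's identity
requires. -/
theorem hittingTime_add_ae_eq (hU : IsDoubleWell U x₀ x₁ x₂) (hε : 0 < ε) (hμ : IsClockLaw μ) :
    ∀ᵐ e ∂μ, hittingTime U ε x₀ (-1) e x₁ + ENNReal.ofReal (x₁ - x₀) =
      ∑' n, {e | Stays U ε x₀ x₁ e n}.indicator (fun _ => (1 : ENNReal)) e *
        ENNReal.ofReal (stayTime U x₀ x₁ (vel n) (ε * e n)) := by
  have hx := hU.lt_left
  filter_upwards [hμ.ae_pos, hμ.ae_ne ε (U x₁ - U x₀) hε, ae_exists_not_stays hU hε hμ]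
    with e hpos hne ⟨n, hn⟩
  obtain ⟨N, -, hF, hv, hN⟩ := exists_exit hne hn
  have hS := staySum_succ_of_exit hU hε hpos hF hv hN
  have hρ : 0 ≤ passTime U ε x₀ x₁ x₂ e N := by
    have : passTime U ε x₀ x₁ x₂ e 0 ≤ passTime U ε x₀ x₁ x₂ e N :=
      monotone_passTime hU hε hpos (Nat.zero_le N)
    rwa [passTime_zero] at this
  rw [hittingTime_of_exit hU hε hpos hF hv hN, ← ENNReal.ofReal_add (by linarith) (by linarith),
    sub_add_cancel, tsum_eq_sum (s := Finset.range (N + 1)), staySum,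
    ENNReal.ofReal_sum_of_nonneg fun i _ => stayTime_nonneg hU _ _]
  · refine Finset.sum_congr rfl fun i hi => ?_
    have : e ∈ {e | Stays U ε x₀ x₁ e i} := fun j hj =>
      hF j (by have := Finset.mem_range.1 hi; omega)
    rw [Set.indicator_of_mem this, one_mul]
  · intro i hi
    have : e ∉ {e | Stays U ε x₀ x₁ e i} := fun h => by
      have := h N (by have := Finset.mem_range.not.1 hi; omega) hv
      linarith
    rw [Set.indicator_of_notMem this, zero_mul]

/-- The hitting time is an infimum over uncountably many times; its measurability is read off from
the almost sure series representation. -/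
theorem aemeasurable_hittingTime (hU : IsDoubleWell U x₀ x₁ x₂) (hε : 0 < ε) (hμ : IsClockLaw μ) :
    AEMeasurable (fun e => hittingTime U ε x₀ (-1) e x₁) μ := by
  refine ⟨fun e => (∑' n, {e | Stays U ε x₀ x₁ e n}.indicator (fun _ => (1 : ENNReal)) e *
    ENNReal.ofReal (stayTime U x₀ x₁ (vel n) (ε * e n))) - ENNReal.ofReal (x₁ - x₀),
    (Measurable.tsum fun n => measurable_indicator_stays_mul hU n).sub
      measurable_const, ?_⟩
  filter_upwards [hittingTime_add_ae_eq hU hε hμ] with e he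
  rw [← he, ENNReal.add_sub_cancel_right ENNReal.ofReal_ne_top]

theorem stayTime_le (hK : ∀ c, (c = x₀ ∨ c = x₂) → ∀ v : ℝ, (v = 1 ∨ v = -1) → ∀ h > 0,
      legTime U c v h ≤ K * (1 + h)) {h : ℝ} (hh : 0 < h) (v : ℝ) : stayTime U x₀ x₁ v h ≤ 2 * K * (1 + h) := by
  unfold stayTime
  split_ifs
  · have := hK x₀ (Or.inl rfl) 1 (Or.inl rfl) h hh
    have := min_le_left (legTime U x₀ 1 h) (x₁ - x₀)
    linarith
  · have := hK x₀ (Or.inl rfl) (-1) (Or.inr rfl) h hh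
    linarith

variable (hU : IsDoubleWell U x₀ x₁ x₂)
  (hK : ∀ c, (c = x₀ ∨ c = x₂) → ∀ v : ℝ, (v = 1 ∨ v = -1) → ∀ h > 0,
      legTime U c v h ≤ K * (1 + h))

include hU hK

theorem abs_stayTime_le {x : ℝ} (hε : 0 < ε) (hε1 : ε ≤ 1) (hx : 0 < x) (v : ℝ) (hK0 : 0 ≤ K) :
    |stayTime U x₀ x₁ v (ε * x)| ≤ 2 * K * (1 + |x|) := by
  rw [abs_of_nonneg (stayTime_nonneg hU _ _), abs_of_pos hx]
  refine (stayTime_le hK (mul_pos hε hx) v).trans ?_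
  gcongr
  exact mul_le_of_le_one_left hx.le hε1

theorem integrable_stayTime (hε : 0 < ε) (v : ℝ) :
    Integrable (fun x => stayTime U x₀ x₁ v (ε * x)) (expMeasure 1) := by
  have hm : Measurable fun x => stayTime U x₀ x₁ v (ε * x) :=
    (measurable_stayTime hU v).comp (by fun_prop)
  refine ⟨hm.aestronglyMeasurable, ?_⟩
  rw [hasFiniteIntegral_iff_norm]
  refine lt_of_le_of_lt (b := ENNReal.ofReal (2 * |K| * (1 + ε)) *
    ∫⁻ x, ENNReal.ofReal ((1 + |x|) ^ 1) ∂expMeasure 1) ?_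
    (ENNReal.mul_lt_top ENNReal.ofReal_lt_top (lintegral_expMeasure_one_pow_lt_top 1))
  rw [← lintegral_const_mul _ (by fun_prop)]
  refine lintegral_mono_ae ?_
  filter_upwards [ae_expMeasure_one_pos] with x hx
  rw [← ENNReal.ofReal_mul (by positivity), Real.norm_eq_abs,
    abs_of_nonneg (stayTime_nonneg hU _ _)]
  refine ENNReal.ofReal_le_ofReal ((stayTime_le hK (mul_pos hε hx) v).trans ?_)
  rw [abs_of_pos hx, pow_one]
  calc 2 * K * (1 + ε * x) ≤ 2 * |K| * (1 + ε * x) := by gcongr; exact le_abs_self K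
    _ ≤ 2 * |K| * ((1 + ε) * (1 + x)) := by gcongr; nlinarith
    _ = _ := by ring

theorem lintegral_stayTime (hε : 0 < ε) :
    ∫⁻ x, ENNReal.ofReal (stayTime U x₀ x₁ (-1) (ε * x)) ∂expMeasure 1 +
      ∫⁻ x, ENNReal.ofReal (stayTime U x₀ x₁ 1 (ε * x)) ∂expMeasure 1 =
      ENNReal.ofReal (meanCycle U ε x₀ x₁) := by
  rw [meanCycle, ENNReal.ofReal_add (integral_nonneg fun x => stayTime_nonneg hU _ _)
    (integral_nonneg fun x => stayTime_nonneg hU _ _),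
    ofReal_integral_eq_lintegral_ofReal (integrable_stayTime hU hK hε _)
      (ae_of_all _ fun x => stayTime_nonneg hU _ _),
    ofReal_integral_eq_lintegral_ofReal (integrable_stayTime hU hK hε _)
      (ae_of_all _ fun x => stayTime_nonneg hU _ _)]

/-- Wald's identity for the exit time of the left well. -/
theorem lintegral_hittingTime (hε : 0 < ε) (hμ : IsClockLaw μ) :
    (∫⁻ e, hittingTime U ε x₀ (-1) e x₁ ∂μ) + ENNReal.ofReal (x₁ - x₀) =
      ENNReal.ofReal (meanCycle U ε x₀ x₁ / Real.exp (-((U x₁ - U x₀) / ε))) := by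
  have := hμ.isProb
  have hx := hU.lt_left
  set p := Real.exp (-((U x₁ - U x₀) / ε)) with hp
  obtain ⟨hp0, hp1⟩ := exp_barrier_mem hU hε
  rw [← hp] at hp0 hp1
  set g : ℕ → (ℕ → ℝ) → ENNReal := fun n e =>
    {e | Stays U ε x₀ x₁ e n}.indicator (fun _ => 1) e *
      ENNReal.ofReal (stayTime U x₀ x₁ (vel n) (ε * e n)) with hg
  have hind : ∀ n, Measurable[past n] ({e | Stays U ε x₀ x₁ e n}.indicator fun _ => (1 : ℝ)) :=
    fun n => (@measurable_const _ _ _ (past n) _).indicator (measurableSet_stays_past n)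
  have hstay : ∀ v, Measurable fun x => ENNReal.ofReal (stayTime U x₀ x₁ v (ε * x)) :=
    measurable_ofReal_stayTime hU
  have hgm : ∀ n, Measurable (g n) := fun n => measurable_indicator_stays_mul hU n
  have hgint : ∀ n, ∫⁻ e, g n e ∂μ = μ {e | Stays U ε x₀ x₁ e n} *
      ∫⁻ x, ENNReal.ofReal (stayTime U x₀ x₁ (vel n) (ε * x)) ∂expMeasure 1 := by
    intro n
    have h := hμ.lintegral_past (hind n)
      (g := fun r x => ENNReal.ofReal r * ENNReal.ofReal (stayTime U x₀ x₁ (vel n) (ε * x)))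
      (measurable_fst.ennreal_ofReal.mul ((hstay _).comp measurable_snd))
    have h1 : ∀ e, ENNReal.ofReal ({e | Stays U ε x₀ x₁ e n}.indicator (fun _ => (1 : ℝ)) e) =
        {e | Stays U ε x₀ x₁ e n}.indicator (fun _ => 1) e := fun e => by
      by_cases he : e ∈ {e | Stays U ε x₀ x₁ e n}
      · rw [Set.indicator_of_mem he, Set.indicator_of_mem he, ENNReal.ofReal_one]
      · rw [Set.indicator_of_notMem he, Set.indicator_of_notMem he, ENNReal.ofReal_zero]
    simp only [h1] at h
    simp only [hg]
    rw [h, ← lintegral_const_mul _ (hstay _)]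
    refine lintegral_congr fun x => ?_
    rw [lintegral_mul_const _
      (measurable_const.indicator (past_le n _ (measurableSet_stays_past n))),
      lintegral_indicator_const (past_le n _ (measurableSet_stays_past n)), one_mul]
  have hae := hittingTime_add_ae_eq hU hε hμ
  calc _ = ∫⁻ e, (hittingTime U ε x₀ (-1) e x₁ + ENNReal.ofReal (x₁ - x₀)) ∂μ := by
        rw [lintegral_add_right _ measurable_const, lintegral_const, measure_univ, mul_one]
    _ = ∑' n, ∫⁻ e, g n e ∂μ := by
        rw [lintegral_congr_ae hae, lintegral_tsum fun n => (hgm n).aemeasurable]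
    -- Legs `2 * k` and `2 * k + 1` have the same probability of being reached, so they combine into
    -- one mean cycle and a geometric series remains.
    _ = ∑' k, ENNReal.ofReal (1 - p) ^ k * ENNReal.ofReal (meanCycle U ε x₀ x₁) := by
        rw [← tsum_even_add_odd ENNReal.summable ENNReal.summable, ← ENNReal.tsum_add]
        congr 1 with k
        rw [hgint, hgint, (measure_stays_even hU hε hμ k).1, (measure_stays_even hU hε hμ k).2,
          vel_even, vel_odd, ← mul_add, lintegral_stayTime hU hK hε]
    _ = _ := by
        rw [ENNReal.tsum_mul_right, ENNReal.tsum_geometric, ← ENNReal.ofReal_one,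
          ← ENNReal.ofReal_sub _ (by linarith), sub_sub_cancel, div_eq_mul_inv, mul_comm,
          ENNReal.ofReal_mul' (inv_nonneg.2 hp0.le), ENNReal.ofReal_inv_of_pos hp0]

/-- Chebyshev's inequality for the sum of the first `2 * k` stay times. -/
theorem measure_staySum_deviation_le (hε : 0 < ε) (hε1 : ε ≤ 1) (hK0 : 0 ≤ K)
    (hμ : IsClockLaw μ) {V : ℝ} (hV : ∫ x, (2 * K * (1 + |x|)) ^ 2 ∂expMeasure 1 ≤ V)
    (k : ℕ) {c : ℝ} (hc : 0 < c) :
    μ {e | c ≤ |staySum U ε x₀ x₁ e (2 * k) - k * meanCycle U ε x₀ x₁|}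
      ≤ ENNReal.ofReal (2 * k * V / c ^ 2) := by
  have := hμ.isProb
  have hL : MemLp (fun x : ℝ => 2 * K * (1 + |x|)) 2 (expMeasure 1) := by
    have hm : AEStronglyMeasurable (fun x : ℝ => 2 * K * (1 + |x|)) (expMeasure 1) :=
      Measurable.aestronglyMeasurable (by fun_prop)
    rw [memLp_two_iff_integrable_sq hm]
    refine ⟨Measurable.aestronglyMeasurable (by fun_prop), ?_⟩
    rw [hasFiniteIntegral_iff_norm]
    refine lt_of_le_of_lt (b := ENNReal.ofReal ((2 * K) ^ 2) *
      ∫⁻ x, ENNReal.ofReal ((1 + |x|) ^ 2) ∂expMeasure 1) ?_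
      (ENNReal.mul_lt_top ENNReal.ofReal_lt_top (lintegral_expMeasure_one_pow_lt_top 2))
    rw [← lintegral_const_mul _ (by fun_prop)]
    refine lintegral_mono fun x => ?_
    simp only
    rw [← ENNReal.ofReal_mul (by positivity), ← mul_pow, Real.norm_eq_abs, abs_of_nonneg (by positivity)]
  have hZL : ∀ v, MemLp (fun x => stayTime U x₀ x₁ v (ε * x)) 2 (expMeasure 1) := fun v => by
    refine hL.mono (((measurable_stayTime hU v).comp (by fun_prop)).aestronglyMeasurable) ?_
    filter_upwards [ae_expMeasure_one_pos] with x hx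
    rw [Real.norm_eq_abs, Real.norm_eq_abs]
    exact (abs_stayTime_le hU hK hε hε1 hx v hK0).trans (le_abs_self _)
  have hvar : ∀ v, variance (fun x => stayTime U x₀ x₁ v (ε * x)) (expMeasure 1) ≤ V := fun v => by
    refine (variance_le_expectation_sq (hZL v).1).trans (le_trans ?_ hV)
    refine integral_mono_ae (hZL v).integrable_sq hL.integrable_sq ?_
    filter_upwards [ae_expMeasure_one_pos] with x hx
    have := abs_stayTime_le hU hK hε hε1 hx v hK0
    simp only [Pi.pow_apply]
    rw [← sq_abs]
    gcongr
  set Z : ℕ → (ℕ → ℝ) → ℝ := fun i e => stayTime U x₀ x₁ (vel i) (ε * e i) with hZ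
  have hlaw : ∀ i, HasLaw (fun e : ℕ → ℝ => e i) (expMeasure 1) μ := fun i =>
    ⟨(measurable_pi_apply i).aemeasurable, hμ.map_eq i⟩
  have hmv : ∀ v, Measurable fun x => stayTime U x₀ x₁ v (ε * x) := fun v =>
    (measurable_stayTime hU v).comp (by fun_prop)
  have hZmem : ∀ i, MemLp (Z i) 2 μ := fun i => by
    have := hZL (vel i)
    rw [← hμ.map_eq i] at this
    exact this.comp_of_map (measurable_pi_apply i).aemeasurable
  have hZvar : ∀ i, variance (Z i) μ ≤ V := fun i => by
    have h := hvar (vel i)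
    rw [← hμ.map_eq i, variance_map (hmv _).aemeasurable (measurable_pi_apply i).aemeasurable] at h
    exact h
  have hZint : ∀ i, ∫ e, Z i e ∂μ = ∫ x, stayTime U x₀ x₁ (vel i) (ε * x) ∂expMeasure 1 := fun i =>
    (hlaw i).integral_comp (f := fun x => stayTime U x₀ x₁ (vel i) (ε * x))
      (hmv _).aestronglyMeasurable
  have hind : iIndepFun Z μ :=
    hμ.indep.comp (fun i x => stayTime U x₀ x₁ (vel i) (ε * x)) fun i => hmv _
  set W : (ℕ → ℝ) → ℝ := ∑ i ∈ Finset.range (2 * k), Z i with hW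
  have hWmem : MemLp W 2 μ := memLp_finsetSum' _ fun i _ => hZmem i
  have hWS : ∀ e, W e = staySum U ε x₀ x₁ e (2 * k) := fun e => by
    simp [hW, hZ, staySum, Finset.sum_apply]
  have hWvar : variance W μ ≤ 2 * k * V := by
    rw [hW, IndepFun.variance_sum (fun i _ => hZmem i) fun i _ j _ hij => hind.indepFun hij]
    refine (Finset.sum_le_sum fun i _ => hZvar i).trans ?_
    simp
  have hWint : ∫ e, W e ∂μ = k * meanCycle U ε x₀ x₁ := by
    simp only [hW, Finset.sum_apply]
    rw [integral_finsetSum _ fun i _ => (hZmem i).integrable (by norm_num)]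
    simp only [hZint]
    clear hW hWmem hWS hWvar W
    induction k with
    | zero => simp
    | succ k ih =>
      rw [show 2 * (k + 1) = (2 * k + 1) + 1 by ring, Finset.sum_range_succ, Finset.sum_range_succ,
        ih, vel_even, vel_odd, meanCycle]
      push_cast
      ring
  have h := meas_ge_le_variance_div_sq hWmem hc
  rw [hWint] at h
  simp only [hWS] at h
  refine h.trans (ENNReal.ofReal_le_ofReal ?_)
  gcongr

end Exit

end VelocityJump

/-! ### Wasserstein distance to a two-point law -/

section Wasserstein

/-- The cost of the coupling that sends `z` to `a` with probability `f z`, and to `b` otherwise. -/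
theorem wassersteinOne_two_points_le_of_density (ν : Measure ℝ) [IsProbabilityMeasure ν] (a b p : ℝ)
    {f : ℝ → ℝ} (hf : Measurable f) (hf0 : ∀ z, 0 ≤ f z) (hf1 : ∀ z, f z ≤ 1)
    (hp : ∫ z, f z ∂ν = p) :
    wassersteinOne ν (ENNReal.ofReal p • Measure.dirac a + ENNReal.ofReal (1 - p) • Measure.dirac b)
      ≤ ∫⁻ z, ENNReal.ofReal (f z * |z - a| + (1 - f z) * |z - b|) ∂ν := by
  have hint : Integrable f ν := Integrable.of_bound hf.aestronglyMeasurable 1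
    (ae_of_all _ fun z => by rw [Real.norm_eq_abs, abs_of_nonneg (hf0 z)]; exact hf1 z)
  set F : ℝ → ENNReal := fun z => ENNReal.ofReal (f z)
  set G : ℝ → ENNReal := fun z => ENNReal.ofReal (1 - f z)
  have hF : Measurable F := hf.ennreal_ofReal
  have hG : Measurable G := (measurable_const.sub hf).ennreal_ofReal
  have hFG : ∀ z, F z + G z = 1 := fun z => by
    rw [← ENNReal.ofReal_add (hf0 z) (by linarith [hf1 z]), add_sub_cancel, ENNReal.ofReal_one]
  have hFu : ∫⁻ z, F z ∂ν = ENNReal.ofReal p := by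
    rw [← hp, ofReal_integral_eq_lintegral_ofReal hint (ae_of_all _ hf0)]
  have hGu : ∫⁻ z, G z ∂ν = ENNReal.ofReal (1 - p) := by
    have hint' : Integrable (fun z => 1 - f z) ν := (integrable_const 1).sub hint
    rw [← ofReal_integral_eq_lintegral_ofReal hint' (ae_of_all _ fun z => sub_nonneg.2 (hf1 z)),
      integral_sub (integrable_const 1) hint, hp]
    simp
  have hma : Measurable fun z : ℝ => (z, a) := by fun_prop
  have hmb : Measurable fun z : ℝ => (z, b) := by fun_prop
  set π : Measure (ℝ × ℝ) := (ν.withDensity F).map (fun z => (z, a)) +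
    (ν.withDensity G).map (fun z => (z, b)) with hπ
  have hfst : π.fst = ν := by
    rw [Measure.fst, hπ, Measure.map_add _ _ measurable_fst, Measure.map_map measurable_fst hma,
      Measure.map_map measurable_fst hmb]
    have h1 : (Prod.fst ∘ fun z : ℝ => (z, a)) = id := rfl
    have h2 : (Prod.fst ∘ fun z : ℝ => (z, b)) = id := rfl
    rw [h1, h2, Measure.map_id, Measure.map_id, ← withDensity_add_left hF]
    have h3 : F + G = 1 := funext hFG
    rw [h3, withDensity_one]
  have hsnd : π.snd = ENNReal.ofReal p • Measure.dirac a +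
      ENNReal.ofReal (1 - p) • Measure.dirac b := by
    rw [Measure.snd, hπ, Measure.map_add _ _ measurable_snd, Measure.map_map measurable_snd hma,
      Measure.map_map measurable_snd hmb]
    have h1 : (Prod.snd ∘ fun z : ℝ => (z, a)) = fun _ => a := rfl
    have h2 : (Prod.snd ∘ fun z : ℝ => (z, b)) = fun _ => b := rfl
    rw [h1, h2, Measure.map_const, Measure.map_const, withDensity_apply _ MeasurableSet.univ,
      withDensity_apply _ MeasurableSet.univ, setLIntegral_univ, setLIntegral_univ, hFu, hGu]
  have hprob : IsProbabilityMeasure π := by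
    constructor
    rw [← Measure.fst_univ, hfst, measure_univ]
  refine (iInf₂_le π ⟨hprob, hfst, hsnd⟩).trans (le_of_eq ?_)
  have hcost : Measurable fun q : ℝ × ℝ => ENNReal.ofReal |q.1 - q.2| := by fun_prop
  rw [hπ, lintegral_add_measure, lintegral_map hcost hma, lintegral_map hcost hmb,
    lintegral_withDensity_eq_lintegral_mul _ hF (by fun_prop),
    lintegral_withDensity_eq_lintegral_mul _ hG (by fun_prop),
    ← lintegral_add_left (hF.mul (by fun_prop))]
  refine lintegral_congr fun z => ?_
  have h1 := hf0 z
  have h2 : 0 ≤ 1 - f z := by linarith [hf1 z]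
  simp only [Pi.mul_apply, F, G]
  rw [ENNReal.ofReal_add (by positivity) (by positivity), ENNReal.ofReal_mul h1,
    ENNReal.ofReal_mul h2]

/-- Send points left of `x` to `a` and the others to `b`, then redirect just enough mass to give `a`
its weight `p`. Redirecting mass `|q - p|` costs at most `|b - a|` per unit beyond the original
cost. -/
theorem wassersteinOne_two_points_le (ν : Measure ℝ) [IsProbabilityMeasure ν] (a x b : ℝ) {p : ℝ}
    (hp0 : 0 ≤ p) (hp1 : p ≤ 1) :
    wassersteinOne ν (ENNReal.ofReal p • Measure.dirac a + ENNReal.ofReal (1 - p) • Measure.dirac b)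
      ≤ ∫⁻ z, ENNReal.ofReal (if z < x then |z - a| else |z - b|) ∂ν +
        ENNReal.ofReal (|b - a| * |ν.real (Set.Iio x) - p|) := by
  set q := ν.real (Set.Iio x) with hq
  have hq0 : 0 ≤ q := measureReal_nonneg
  have hq1 : q ≤ 1 := measureReal_le_one
  have hqc : ν.real (Set.Iio x)ᶜ = 1 - q := by
    rw [measureReal_compl measurableSet_Iio]; simp [hq]
  have hInt : ∀ α β : ℝ, ∫ z, (if z < x then α else β) ∂ν = α * q + β * (1 - q) := by
    intro α β
    have h : (fun z => if z < x then α else β) = fun z =>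
        (Set.Iio x).indicator (fun _ => α) z + (Set.Iio x)ᶜ.indicator (fun _ => β) z := by
      ext z; by_cases hz : z < x <;> simp [Set.indicator_apply, hz]
    rw [h, integral_add ((integrable_const α).indicator measurableSet_Iio)
      ((integrable_const β).indicator measurableSet_Iio.compl),
      integral_indicator_const _ measurableSet_Iio,
      integral_indicator_const _ measurableSet_Iio.compl, hqc, smul_eq_mul, smul_eq_mul]
    ring
  -- `α` and `β` are the probabilities of being sent to `a` from the left and from the right of `x`.
  -- The first equation fixes the mass at `a`, the second says that the redirected mass is `|q -
  -- p|`.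
  have key : ∀ α β : ℝ, 0 ≤ α → α ≤ 1 → 0 ≤ β → β ≤ 1 → α * q + β * (1 - q) = p →
      (1 - α) * q + β * (1 - q) = |q - p| →
      wassersteinOne ν (ENNReal.ofReal p • Measure.dirac a +
        ENNReal.ofReal (1 - p) • Measure.dirac b) ≤
        ∫⁻ z, ENNReal.ofReal (if z < x then |z - a| else |z - b|) ∂ν +
          ENNReal.ofReal (|b - a| * |q - p|) := by
    intro α β hα hα1 hβ hβ1 h1 h2
    have hm : ∀ α β : ℝ, Measurable fun z : ℝ => if z < x then α else β := fun α β =>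
      Measurable.ite measurableSet_Iio measurable_const measurable_const
    refine (wassersteinOne_two_points_le_of_density ν a b p (hm α β)
      (fun z => by split_ifs <;> assumption) (fun z => by split_ifs <;> assumption)
      (by rw [hInt, h1])).trans ?_
    have h3 : ENNReal.ofReal (|b - a| * |q - p|) =
        ∫⁻ z, ENNReal.ofReal (|b - a| * if z < x then 1 - α else β) ∂ν := by
      rw [← h2, ← hInt, ← integral_const_mul, ofReal_integral_eq_lintegral_ofReal]
      · refine Integrable.of_bound ((hm _ _).const_mul _).aestronglyMeasurable |b - a|
          (ae_of_all _ fun z => ?_)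
        rw [Real.norm_eq_abs, abs_mul, abs_abs]
        refine mul_le_of_le_one_right (abs_nonneg _) ?_
        split_ifs <;> rw [abs_le] <;> constructor <;> linarith
      · refine ae_of_all _ fun z => mul_nonneg (abs_nonneg _) ?_
        split_ifs <;> linarith
    rw [h3, ← lintegral_add_right _ (((hm _ _).const_mul _).ennreal_ofReal)]
    refine lintegral_mono fun z => ?_
    simp only
    have t1 : |z - b| ≤ |z - a| + |b - a| := by
      rw [abs_sub_comm b a]; exact abs_sub_le z a b
    have t2 : |z - a| ≤ |z - b| + |b - a| := abs_sub_le z b a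
    split_ifs
    · rw [← ENNReal.ofReal_add (abs_nonneg _) (mul_nonneg (abs_nonneg _) (by linarith))]
      refine ENNReal.ofReal_le_ofReal ?_
      nlinarith [mul_le_mul_of_nonneg_left t1 (sub_nonneg.2 hα1)]
    · rw [← ENNReal.ofReal_add (abs_nonneg _) (mul_nonneg (abs_nonneg _) (by linarith))]
      refine ENNReal.ofReal_le_ofReal ?_
      nlinarith [mul_le_mul_of_nonneg_left t2 hβ]
  -- If the left side carries too much mass, only left points are redirected; otherwise only right
  -- points are.
  rcases le_or_gt p q with h | h
  · have hpq : p / q * q = p := by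
      rcases hq0.eq_or_lt with h0 | h0
      · rw [← h0] at h ⊢; simp; linarith
      · exact div_mul_cancel₀ _ h0.ne'
    refine key (p / q) 0 (by positivity) (div_le_one_of_le₀ h hq0) le_rfl zero_le_one ?_ ?_
    · rw [hpq]; ring
    · rw [abs_of_nonneg (by linarith), sub_mul, hpq]; ring
  · have hq1' : 0 < 1 - q := by linarith
    have hpq : (p - q) / (1 - q) * (1 - q) = p - q := div_mul_cancel₀ _ hq1'.ne'
    refine key 1 ((p - q) / (1 - q)) zero_le_one le_rfl (div_nonneg (by linarith) hq1'.le)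
      ((div_le_one hq1').2 (by linarith)) ?_ ?_
    · rw [hpq]; ring
    · rw [abs_of_nonpos (by linarith), hpq]; ring

end Wasserstein

/-! ### Two elementary limits -/

section Limits

theorem tendsto_pow_mul_exp_neg_inv {a : ℝ} (ha : 0 < a) (k : ℕ) :
    Tendsto (fun ε : ℝ => Real.exp (-(a / ε)) / ε ^ k) (𝓝[>] 0) (𝓝 0) := by
  have h := (tendsto_rpow_mul_exp_neg_mul_atTop_nhds_zero k a ha).comp tendsto_inv_nhdsGT_zero
  refine h.congr fun ε => ?_
  simp only [Function.comp_apply, Real.rpow_natCast, inv_pow]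
  rw [div_eq_inv_mul, neg_mul, ← div_eq_mul_inv]

/-- Take logarithms: `⌈θ / x⌉₊ * x` tends to `θ`, and `log (1 - x) / x` tends to `-1` as the
derivative of `log (1 - x)` at `0`. -/
theorem tendsto_one_sub_pow_ceil {ι : Type*} {l : Filter ι} {p : ι → ℝ} {θ : ℝ} (hθ : 0 ≤ θ)
    (hp : Tendsto p l (𝓝[>] 0)) :
    Tendsto (fun i => (1 - p i) ^ ⌈θ / p i⌉₊) l (𝓝 (Real.exp (-θ))) := by
  have h1 : Tendsto (fun x : ℝ => (⌈θ / x⌉₊ : ℝ) * x) (𝓝[>] 0) (𝓝 θ) := by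
    refine ((tendsto_nat_ceil_mul_div_atTop hθ).comp tendsto_inv_nhdsGT_zero).congr fun x => ?_
    simp [div_eq_mul_inv]
  have h2 : Tendsto (fun x : ℝ => x⁻¹ * Real.log (1 - x)) (𝓝[>] 0) (𝓝 (-1)) := by
    have hd : HasDerivAt (fun x : ℝ => Real.log (1 - x)) (-1) 0 := by
      have := ((hasDerivAt_id (0:ℝ)).const_sub 1).log (by norm_num)
      simpa using this
    have := hd.tendsto_slope_zero_right
    simpa using this
  have h3 := (Real.continuous_exp.tendsto _).comp (h1.mul h2)
  rw [mul_neg_one] at h3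
  refine Tendsto.comp (g := fun x : ℝ => (1 - x) ^ ⌈θ / x⌉₊) ?_ hp
  refine h3.congr' ?_
  filter_upwards [Ioo_mem_nhdsGT (zero_lt_one' ℝ)] with x hx
  have hx1 : 0 < 1 - x := by linarith [hx.2]
  have hx0 := hx.1.ne'
  simp only [Function.comp_apply]
  rw [← Real.rpow_natCast, Real.rpow_def_of_pos hx1]
  congr 1
  field_simp

end Limits

/-! ### Asymptotics at the time scale of the mean exit time -/

namespace VelocityJump

section Metastability

variable {U : ℝ → ℝ} {ε x₀ x₁ x₂ κ K : ℝ} {μ : Measure (ℕ → ℝ)}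

theorem meanCycle_nonneg (hU : IsDoubleWell U x₀ x₁ x₂) : 0 ≤ meanCycle U ε x₀ x₁ :=
  add_nonneg (integral_nonneg fun _ => stayTime_nonneg hU _ _)
    (integral_nonneg fun _ => stayTime_nonneg hU _ _)

theorem toReal_lintegral_hittingTime (hU : IsDoubleWell U x₀ x₁ x₂)
    (hK : ∀ c, (c = x₀ ∨ c = x₂) → ∀ v : ℝ, (v = 1 ∨ v = -1) → ∀ h > 0,
      legTime U c v h ≤ K * (1 + h)) (hε : 0 < ε) (hμ : IsClockLaw μ) :
    (∫⁻ e, hittingTime U ε x₀ (-1) e x₁ ∂μ).toReal =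
      meanCycle U ε x₀ x₁ / Real.exp (-((U x₁ - U x₀) / ε)) - (x₁ - x₀) := by
  have h := lintegral_hittingTime hU hK hε hμ
  have hfin : ∫⁻ e, hittingTime U ε x₀ (-1) e x₁ ∂μ ≠ ⊤ := fun htop => by
    rw [htop, top_add] at h
    exact ENNReal.ofReal_ne_top h.symm
  have h2 := congrArg ENNReal.toReal h
  rw [ENNReal.toReal_add hfin ENNReal.ofReal_ne_top,
    ENNReal.toReal_ofReal (by linarith [hU.lt_left]),
    ENNReal.toReal_ofReal (div_nonneg (meanCycle_nonneg hU) (Real.exp_pos _).le)] at h2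
  linarith

/-- A leftward leg whose clock is at least `1`, an event of probability `exp (-1)`, lasts at least
`κ * ε` each way. -/
theorem le_meanCycle (hU : IsDoubleWell U x₀ x₁ x₂)
    (hK : ∀ c, (c = x₀ ∨ c = x₂) → ∀ v : ℝ, (v = 1 ∨ v = -1) → ∀ h > 0,
      legTime U c v h ≤ K * (1 + h))
    (hgap : ∀ c, (c = x₀ ∨ c = x₂) → ∀ v : ℝ, (v = 1 ∨ v = -1) → ∀ h > 0,
      κ * min 1 h ≤ legTime U c v h) (hκ : 0 < κ) (hε : 0 < ε) (hε1 : ε ≤ 1) :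
    2 * κ * Real.exp (-1) * ε ≤ meanCycle U ε x₀ x₁ := by
  have h1 : ∫ x, (Set.Ici (1 : ℝ)).indicator (fun _ => 2 * κ * ε) x ∂expMeasure 1 ≤
      ∫ x, stayTime U x₀ x₁ (-1) (ε * x) ∂expMeasure 1 := by
    refine integral_mono ((integrable_const _).indicator measurableSet_Ici)
      (integrable_stayTime hU hK hε _) fun x => ?_
    by_cases hx : x ∈ Set.Ici (1 : ℝ)
    · rw [Set.indicator_of_mem hx, stayTime, if_neg (by norm_num)]
      have hx' : (1 : ℝ) ≤ x := hx
      have h2 := hgap x₀ (Or.inl rfl) (-1) (Or.inr rfl) (ε * x) (by positivity)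
      have h3 : ε ≤ min 1 (ε * x) := le_min hε1 (le_mul_of_one_le_right hε.le hx')
      have h4 := mul_le_mul_of_nonneg_left h3 hκ.le
      linarith
    · rw [Set.indicator_of_notMem hx]
      exact stayTime_nonneg hU _ _
  rw [integral_indicator_const _ measurableSet_Ici, measureReal_def,
    expMeasure_one_Ici zero_le_one, ENNReal.toReal_ofReal (Real.exp_pos _).le, smul_eq_mul] at h1
  have h2 : 0 ≤ ∫ x, stayTime U x₀ x₁ 1 (ε * x) ∂expMeasure 1 :=
    integral_nonneg fun _ => stayTime_nonneg hU _ _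
  rw [meanCycle]
  linarith

theorem meanCycle_le (hU : IsDoubleWell U x₀ x₁ x₂)
    (hK : ∀ c, (c = x₀ ∨ c = x₂) → ∀ v : ℝ, (v = 1 ∨ v = -1) → ∀ h > 0,
      legTime U c v h ≤ K * (1 + h)) (hK0 : 0 ≤ K) (hε : 0 < ε) (hε1 : ε ≤ 1) :
    meanCycle U ε x₀ x₁ ≤ 2 * ∫ x, 2 * K * (1 + |x|) ∂expMeasure 1 := by
  have hint : Integrable (fun x : ℝ => 2 * K * (1 + |x|)) (expMeasure 1) := by
    refine Integrable.const_mul ⟨Measurable.aestronglyMeasurable (by fun_prop), ?_⟩ _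
    rw [hasFiniteIntegral_iff_norm]
    refine lt_of_le_of_lt (lintegral_mono fun x => ?_) (lintegral_expMeasure_one_pow_lt_top 1)
    rw [Real.norm_eq_abs, abs_of_nonneg (by positivity), pow_one]
  have h : ∀ v, ∫ x, stayTime U x₀ x₁ v (ε * x) ∂expMeasure 1 ≤
      ∫ x, 2 * K * (1 + |x|) ∂expMeasure 1 := fun v => by
    refine integral_mono_ae (integrable_stayTime hU hK hε v) hint ?_
    filter_upwards [ae_expMeasure_one_pos] with x hx
    exact (le_abs_self _).trans (abs_stayTime_le hU hK hε hε1 hx v hK0)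
  rw [meanCycle, two_mul]
  exact add_le_add (h _) (h _)

/-- Being left of `x₁` at time `s` forces one of three events: the first `k` attempts all failed,
they take longer than `s`, or some clock started before `s` is large enough for a return. -/
theorem measure_position_lt_le (hU : IsDoubleWell U x₀ x₁ x₂)
    (hgap : ∀ c, (c = x₀ ∨ c = x₂) → ∀ v : ℝ, (v = 1 ∨ v = -1) → ∀ h > 0,
      κ * min 1 h ≤ legTime U c v h) (hκ : 0 < κ) (hlt : U x₂ < U x₁) (hε : 0 < ε) (hε1 : ε ≤ 1)
    (hμ : IsClockLaw μ) {s : ℝ} (hs : 0 ≤ s) (k : ℕ) :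
    μ.real {e | position U ε x₀ (-1) e s < x₁} ≤
      (1 - Real.exp (-((U x₁ - U x₀) / ε))) ^ k + μ.real {e | s < staySum U ε x₀ x₁ e (2 * k)} +
      Real.exp (-((U x₁ - U x₂) / ε)) * (((s + 1) / (κ * ε) + 1) * Real.exp 1) := by
  have := hμ.isProb
  obtain ⟨hp0, hp1⟩ := exp_barrier_mem hU hε
  have hF : μ.real {e | Stays U ε x₀ x₁ e (2 * k)} =
      (1 - Real.exp (-((U x₁ - U x₀) / ε))) ^ k := by
    rw [measureReal_def, (measure_stays_even hU hε hμ k).1, ENNReal.toReal_pow,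
      ENNReal.toReal_ofReal (by linarith)]
  have hR := measure_return_le hU hε hμ hκ hε1 hgap hs (D := U x₁ - U x₂) (by linarith)
  have hR' := ENNReal.toReal_le_of_le_ofReal (by positivity) hR
  rw [← hF]
  refine le_trans ?_ (add_le_add le_rfl hR')
  rw [← measureReal_def]
  refine le_trans (ENNReal.toReal_mono (measure_ne_top _ _) (measure_mono_ae
    (t := {e | Stays U ε x₀ x₁ e (2 * k)} ∪ {e | s < staySum U ε x₀ x₁ e (2 * k)} ∪
      {e | ∃ n, passTime U ε x₀ x₁ x₂ e n ≤ s ∧ U x₁ - U x₂ < ε * e n}) ?_))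
    ((measureReal_union_le _ _).trans (add_le_add (measureReal_union_le _ _) le_rfl))
  filter_upwards [hμ.ae_pos, hμ.ae_ne ε (U x₁ - U x₀) hε,
    ae_exists_lt_passTime hU hε hμ hκ hε1 hgap s] with e hpos hne hfin
  intro (hX : position U ε x₀ (-1) e s < x₁)
  by_cases h1 : Stays U ε x₀ x₁ e (2 * k)
  · exact Or.inl (Or.inl h1)
  by_cases h2 : s < staySum U ε x₀ x₁ e (2 * k)
  · exact Or.inl (Or.inr h2)
  by_cases h3 : ∃ n, passTime U ε x₀ x₁ x₂ e n ≤ s ∧ U x₁ - U x₂ < ε * e n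
  · exact Or.inr h3
  push Not at h3
  exact absurd (le_position_of_exit hU hε hpos hne hfin h1 (not_lt.1 h2) fun i hi _ => h3 i hi)
    (not_le.2 hX)

theorem le_measure_position_lt (hU : IsDoubleWell U x₀ x₁ x₂) (hε : 0 < ε)
    (hμ : IsClockLaw μ) {s : ℝ} (hs : 0 ≤ s) (k : ℕ) :
    (1 - Real.exp (-((U x₁ - U x₀) / ε))) ^ k ≤ μ.real {e | position U ε x₀ (-1) e s < x₁} +
      μ.real {e | staySum U ε x₀ x₁ e (2 * k) ≤ s} := by
  have := hμ.isProb
  obtain ⟨hp0, hp1⟩ := exp_barrier_mem hU hε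
  have hF : μ.real {e | Stays U ε x₀ x₁ e (2 * k)} =
      (1 - Real.exp (-((U x₁ - U x₀) / ε))) ^ k := by
    rw [measureReal_def, (measure_stays_even hU hε hμ k).1, ENNReal.toReal_pow,
      ENNReal.toReal_ofReal (by linarith)]
  rw [← hF]
  refine le_trans (ENNReal.toReal_mono (measure_ne_top _ _) (measure_mono_ae
    (t := {e | position U ε x₀ (-1) e s < x₁} ∪ {e | staySum U ε x₀ x₁ e (2 * k) ≤ s}) ?_))
    (measureReal_union_le _ _)
  filter_upwards [hμ.ae_pos] with e hpos
  intro (hX : Stays U ε x₀ x₁ e (2 * k))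
  by_cases h : staySum U ε x₀ x₁ e (2 * k) ≤ s
  · exact Or.inr h
  · refine Or.inl (position_lt_of_stays hU hε hpos hX hs ?_)
    rw [(stays_bottom hU hε hpos hX).2]
    exact not_le.1 h

theorem tendsto_exp_barrier (hU : IsDoubleWell U x₀ x₁ x₂) :
    Tendsto (fun ε => Real.exp (-((U x₁ - U x₀) / ε))) (𝓝[>] 0) (𝓝[>] 0) := by
  refine tendsto_nhdsWithin_iff.2 ⟨?_, Eventually.of_forall fun _ => Real.exp_pos _⟩
  simpa using tendsto_pow_mul_exp_neg_inv (sub_pos.2 hU.barrier_pos) 0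

/-- The error in Chebyshev's inequality is negligible at the exit time scale. -/
theorem tendsto_deviation_bound (hU : IsDoubleWell U x₀ x₁ x₂) {c V θ d : ℝ} (hc : 0 < c)
    (hm : ∀ ε, 0 < ε → ε ≤ 1 → c * ε ≤ meanCycle U ε x₀ x₁) (hV : 0 ≤ V) (hθ : 0 < θ)
    (hd : 0 < d) :
    Tendsto (fun ε => 2 * (⌈θ / Real.exp (-((U x₁ - U x₀) / ε))⌉₊ : ℝ) * V /
      (d * (meanCycle U ε x₀ x₁ / Real.exp (-((U x₁ - U x₀) / ε)))) ^ 2) (𝓝[>] 0) (𝓝 0) := by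
  -- With `m ≥ c * ε` and `⌈θ / p⌉₊ ≤ (θ + 1) / p`, the quotient is at most a constant times `p / ε
  -- ^ 2`.
  have hlim := (tendsto_pow_mul_exp_neg_inv (sub_pos.2 hU.barrier_pos) 2).const_mul
    (2 * (θ + 1) * V / (d * c) ^ 2)
  rw [mul_zero] at hlim
  refine tendsto_of_tendsto_of_tendsto_of_le_of_le' tendsto_const_nhds hlim
    (Eventually.of_forall fun ε => by positivity) ?_
  filter_upwards [Ioc_mem_nhdsGT (zero_lt_one' ℝ)] with ε hε
  obtain ⟨hp0, hp1⟩ := exp_barrier_mem hU hε.1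
  set p := Real.exp (-((U x₁ - U x₀) / ε))
  have hε0 := hε.1
  have hm' := hm ε hε.1 hε.2
  have hceil : (⌈θ / p⌉₊ : ℝ) ≤ (θ + 1) / p := by
    have h1 : (⌈θ / p⌉₊ : ℝ) ≤ θ / p + 1 := (Nat.ceil_lt_add_one (by positivity)).le
    have h2 : 1 ≤ 1 / p := (one_le_div hp0).2 hp1.le
    rw [add_div]; linarith
  calc _ ≤ 2 * ((θ + 1) / p) * V / (d * (c * ε / p)) ^ 2 := by gcongr
    _ = _ := by field_simp

theorem tendsto_measure_position_lt (hU : IsDoubleWell U x₀ x₁ x₂)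
    (hlt : U x₂ < U x₀) (hμ : IsClockLaw μ) {t : ℝ} (ht : 0 < t) :
    Tendsto (fun ε => μ.real {e | position U ε x₀ (-1) e
      (t * (∫⁻ e, hittingTime U ε x₀ (-1) e x₁ ∂μ).toReal) < x₁}) (𝓝[>] 0)
      (𝓝 (Real.exp (-t))) := by
  have := hμ.isProb
  obtain ⟨κ, hκ, K, hK0, hbounds⟩ := exists_legTime_bounds hU
  have hgap : ∀ c, (c = x₀ ∨ c = x₂) → ∀ v : ℝ, (v = 1 ∨ v = -1) → ∀ h > 0,
      κ * min 1 h ≤ legTime U c v h := fun c hc v hv h hh => (hbounds c hc v hv h hh).1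
  have hK : ∀ c, (c = x₀ ∨ c = x₂) → ∀ v : ℝ, (v = 1 ∨ v = -1) → ∀ h > 0,
      legTime U c v h ≤ K * (1 + h) := fun c hc v hv h hh => (hbounds c hc v hv h hh).2
  set V := ∫ x, (2 * K * (1 + |x|)) ^ 2 ∂expMeasure 1
  have hV : 0 ≤ V := integral_nonneg fun x => by positivity
  set M := 2 * ∫ x, 2 * K * (1 + |x|) ∂expMeasure 1
  have hM : 0 ≤ M := mul_nonneg zero_le_two (integral_nonneg fun x => by positivity)
  set c₁ := 2 * κ * Real.exp (-1)
  have hc₁ : 0 < c₁ := by positivity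
  have hmge : ∀ ε, 0 < ε → ε ≤ 1 → c₁ * ε ≤ meanCycle U ε x₀ x₁ := fun ε h0 h1 =>
    le_meanCycle hU hK hgap hκ h0 h1
  set s : ℝ → ℝ := fun ε => t * (∫⁻ e, hittingTime U ε x₀ (-1) e x₁ ∂μ).toReal
  have hs0 : ∀ ε, 0 ≤ s ε := fun ε => mul_nonneg ht.le ENNReal.toReal_nonneg
  have hs : ∀ ε, 0 < ε → s ε =
      t * (meanCycle U ε x₀ x₁ / Real.exp (-((U x₁ - U x₀) / ε)) - (x₁ - x₀)) := fun ε h0 => by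
    simp only [s]
    rw [toReal_lintegral_hittingTime hU hK h0 hμ]
  have hx := hU.lt_left
  have hbar := hU.barrier_pos
  have hpow : ∀ θ, 0 < θ → Tendsto (fun ε => (1 - Real.exp (-((U x₁ - U x₀) / ε))) ^
      ⌈θ / Real.exp (-((U x₁ - U x₀) / ε))⌉₊) (𝓝[>] 0) (𝓝 (Real.exp (-θ))) := fun θ hθ =>
    tendsto_one_sub_pow_ceil hθ.le (tendsto_exp_barrier hU)
  rw [tendsto_order]
  constructor
  · intro a ha
    -- For the lower bound allow slightly more attempts than fit, `θ > t`: their total duration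
    -- concentrates above `s ε`, so if all fail the particle is still left of `x₁`.
    obtain ⟨θ, hθt, hθ⟩ : ∃ θ > t, a < Real.exp (-θ) := by
      have hcont : Tendsto (fun θ => Real.exp (-θ)) (𝓝[>] t) (𝓝 (Real.exp (-t))) :=
        (Real.continuous_exp.comp continuous_neg).continuousWithinAt
      obtain ⟨θ, h1, h2⟩ := ((hcont.eventually_const_lt ha).and self_mem_nhdsWithin).exists
      exact ⟨θ, h2, h1⟩
    have hθ0 : 0 < θ := ht.trans hθt
    have hd : 0 < θ - t := by linarith
    have hlim := (hpow θ hθ0).sub (tendsto_deviation_bound hU hc₁ hmge hV hθ0 hd)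
    rw [sub_zero] at hlim
    filter_upwards [hlim.eventually_const_lt hθ, Ioc_mem_nhdsGT (zero_lt_one' ℝ)] with ε hε1 hε
    refine hε1.trans_le ?_
    obtain ⟨hp0, hp1⟩ := exp_barrier_mem hU hε.1
    have hlow := le_measure_position_lt hU hε.1 hμ (hs0 ε)
      ⌈θ / Real.exp (-((U x₁ - U x₀) / ε))⌉₊
    have hm := hmge ε hε.1 hε.2
    have hm0 : 0 < meanCycle U ε x₀ x₁ := (mul_pos hc₁ hε.1).trans_le hm
    have hsε := hs ε hε.1
    set p := Real.exp (-((U x₁ - U x₀) / ε))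
    set m := meanCycle U ε x₀ x₁
    set k := ⌈θ / p⌉₊
    have hc : 0 < (θ - t) * (m / p) := by positivity
    have hdev := measure_staySum_deviation_le hU hK hε.1 hε.2 hK0.le hμ (V := V) le_rfl k hc
    have hdev' := ENNReal.toReal_le_of_le_ofReal (by positivity) hdev
    have hsub : μ.real {e | staySum U ε x₀ x₁ e (2 * k) ≤ s ε} ≤
        μ.real {e | (θ - t) * (m / p) ≤ |staySum U ε x₀ x₁ e (2 * k) - k * m|} := by
      refine measureReal_mono fun e (he : _ ≤ s ε) => ?_
      have hk : θ / p * m ≤ k * m := mul_le_mul_of_nonneg_right (Nat.le_ceil _) hm0.le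
      have h1 : (θ - t) * (m / p) = θ / p * m - t * (m / p) := by ring
      have h2 : s ε ≤ t * (m / p) := by
        rw [hsε]; exact mul_le_mul_of_nonneg_left (by linarith) ht.le
      change (θ - t) * (m / p) ≤ |staySum U ε x₀ x₁ e (2 * k) - k * m|
      rw [h1, abs_sub_comm]
      exact le_trans (by linarith) (le_abs_self _)
    rw [← measureReal_def] at hdev'
    linarith
  · intro b hb
    -- For the upper bound take `θ < t`, so that the attempts are finished by time `s ε` with high
    -- probability. Half of the margin `t - θ` is for fluctuations; the other half absorbs rounding
    -- and the shift `x₁ - x₀`.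
    obtain ⟨θ, hθ0, hθt, hθ⟩ : ∃ θ, 0 < θ ∧ θ < t ∧ Real.exp (-θ) < b := by
      have hcont : Tendsto (fun θ => Real.exp (-θ)) (𝓝[<] t) (𝓝 (Real.exp (-t))) :=
        (Real.continuous_exp.comp continuous_neg).continuousWithinAt
      obtain ⟨θ, h1, h2⟩ := ((hcont.eventually_lt_const hb).and (Ioo_mem_nhdsLT ht)).exists
      exact ⟨θ, h2.1, h2.2, h1⟩
    have hd : 0 < (t - θ) / 2 := by linarith
    have hret : Tendsto (fun ε => Real.exp (-((U x₁ - U x₂) / ε)) *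
        (((s ε + 1) / (κ * ε) + 1) * Real.exp 1)) (𝓝[>] 0) (𝓝 0) := by
      have h := (tendsto_pow_mul_exp_neg_inv (sub_pos.2 hlt) 1).const_mul
        (((t * M + 1) / κ + 1) * Real.exp 1)
      rw [mul_zero] at h
      refine tendsto_of_tendsto_of_tendsto_of_le_of_le' tendsto_const_nhds h ?_ ?_
      · filter_upwards [self_mem_nhdsWithin] with ε (hε : 0 < ε)
        have := hs0 ε
        positivity
      · filter_upwards [Ioc_mem_nhdsGT (zero_lt_one' ℝ)] with ε hε
        obtain ⟨hp0, hp1⟩ := exp_barrier_mem hU hε.1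
        have hε0 := hε.1
        -- The time is of order `1 / p`. Dividing the return probability by `p` leaves the
        -- exponential of the depth difference of the wells; this is where the right well must be
        -- deeper.
        have hexp : Real.exp (-((U x₀ - U x₂) / ε)) =
            Real.exp (-((U x₁ - U x₂) / ε)) / Real.exp (-((U x₁ - U x₀) / ε)) := by
          rw [← Real.exp_sub]; congr 1; ring
        have hsε := hs ε hε.1
        have hmM := meanCycle_le hU hK hK0.le hε.1 hε.2
        rw [hexp]
        set p := Real.exp (-((U x₁ - U x₀) / ε))
        have h1 : s ε ≤ t * M / p := by
          rw [hsε, mul_div_assoc]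
          have : meanCycle U ε x₀ x₁ / p ≤ M / p := by gcongr
          exact mul_le_mul_of_nonneg_left (by linarith) ht.le
        have h2 : 1 ≤ 1 / p := (one_le_div hp0).2 hp1.le
        have h3 : s ε + 1 ≤ (t * M + 1) / p := by rw [add_div]; linarith
        have h4 : 1 ≤ 1 / (p * ε) :=
          (one_le_div (by positivity)).2 (mul_le_one₀ hp1.le hε.1.le hε.2)
        have h5 : (s ε + 1) / (κ * ε) + 1 ≤ ((t * M + 1) / κ + 1) / (p * ε) := by
          calc _ ≤ (t * M + 1) / p / (κ * ε) + 1 / (p * ε) := by gcongr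
            _ = _ := by field_simp
        calc _ ≤ Real.exp (-((U x₁ - U x₂) / ε)) *
              (((t * M + 1) / κ + 1) / (p * ε) * Real.exp 1) := by gcongr
          _ = _ := by field_simp
    have hlim := ((hpow θ hθ0).add (tendsto_deviation_bound hU hc₁ hmge hV hθ0 hd)).add hret
    rw [add_zero, add_zero] at hlim
    -- Multiplied by `m / p` with `m ≥ c₁ * ε`, this dominates `m + t * (x₁ - x₀)`, the cost of the
    -- ceiling and of the shift in Wald's identity.
    have hsmall : Tendsto (fun ε => Real.exp (-((U x₁ - U x₀) / ε)) / ε ^ 0 +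
        t * (x₁ - x₀) / c₁ * (Real.exp (-((U x₁ - U x₀) / ε)) / ε ^ 1)) (𝓝[>] 0) (𝓝 0) := by
      have := (tendsto_pow_mul_exp_neg_inv (sub_pos.2 hbar) 0).add
        ((tendsto_pow_mul_exp_neg_inv (sub_pos.2 hbar) 1).const_mul (t * (x₁ - x₀) / c₁))
      simpa using this
    filter_upwards [hlim.eventually_lt_const hθ, Ioc_mem_nhdsGT (zero_lt_one' ℝ),
      hsmall.eventually_lt_const hd] with ε hε1 hε hεs
    refine lt_of_le_of_lt ?_ hε1
    obtain ⟨hp0, hp1⟩ := exp_barrier_mem hU hε.1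
    have hup := measure_position_lt_le hU hgap hκ (by linarith) hε.1 hε.2 hμ (hs0 ε)
      ⌈θ / Real.exp (-((U x₁ - U x₀) / ε))⌉₊
    have hm := hmge ε hε.1 hε.2
    have hε0 := hε.1
    have hm0 : 0 < meanCycle U ε x₀ x₁ := (mul_pos hc₁ hε.1).trans_le hm
    have hsε := hs ε hε.1
    set p := Real.exp (-((U x₁ - U x₀) / ε))
    set m := meanCycle U ε x₀ x₁
    set k := ⌈θ / p⌉₊
    have hc : 0 < (t - θ) / 2 * (m / p) := by positivity
    have hdev := measure_staySum_deviation_le hU hK hε.1 hε.2 hK0.le hμ (V := V) le_rfl k hc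
    have hdev' := ENNReal.toReal_le_of_le_ofReal (by positivity) hdev
    have hk : k * m ≤ (θ / p + 1) * m :=
      mul_le_mul_of_nonneg_right (Nat.ceil_lt_add_one (by positivity)).le hm0.le
    have h6 : t * (x₁ - x₀) + m ≤ (t - θ) / 2 * (m / p) := by
      rw [pow_zero, div_one, pow_one] at hεs
      have h7 : t * (x₁ - x₀) ≤ t * (x₁ - x₀) / (c₁ * ε) * m := by
        rw [div_mul_eq_mul_div, le_div_iff₀ (by positivity)]
        exact mul_le_mul_of_nonneg_left hm (mul_nonneg ht.le (by linarith))
      have h8 := mul_le_mul_of_nonneg_right hεs.le (show 0 ≤ m / p by positivity)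
      have h9 : (p + t * (x₁ - x₀) / c₁ * (p / ε)) * (m / p) =
          m + t * (x₁ - x₀) / (c₁ * ε) * m := by field_simp
      linarith
    have hsub : μ.real {e | s ε < staySum U ε x₀ x₁ e (2 * k)} ≤
        μ.real {e | (t - θ) / 2 * (m / p) ≤ |staySum U ε x₀ x₁ e (2 * k) - k * m|} := by
      refine measureReal_mono fun e (he : s ε < _) => ?_
      have h1 : (θ / p + 1) * m = θ * (m / p) + m := by ring
      change (t - θ) / 2 * (m / p) ≤ |staySum U ε x₀ x₁ e (2 * k) - k * m|
      refine le_trans ?_ (le_abs_self _)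
      rw [hsε] at he
      linarith
    rw [← measureReal_def] at hdev'
    linarith

theorem eventually_lintegral_dist_bottom_le (hU : IsDoubleWell U x₀ x₁ x₂) (hμ : IsClockLaw μ)
    {δ : ℝ} (hδ : 0 < δ) :
    ∀ᶠ ε in 𝓝[>] 0, ∀ s, 0 ≤ s → ∫⁻ e, ENNReal.ofReal (if position U ε x₀ (-1) e s < x₁ then
        |position U ε x₀ (-1) e s - x₀| else |position U ε x₀ (-1) e s - x₂|) ∂μ
      ≤ ENNReal.ofReal δ := by
  have hx := hU.lt_left
  have hx2 := hU.lt_right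
  obtain ⟨κ, hκ, K', hK0', hbounds⟩ := exists_legTime_bounds hU
  set K := max K' (x₂ - x₀)
  have hK0 : 0 < K := lt_max_of_lt_left hK0'
  have hgap : ∀ c, (c = x₀ ∨ c = x₂) → ∀ v : ℝ, (v = 1 ∨ v = -1) → ∀ h > 0,
      κ * min 1 h ≤ legTime U c v h := fun c hc v hv h hh => (hbounds c hc v hv h hh).1
  have hK : ∀ c, (c = x₀ ∨ c = x₂) → ∀ v : ℝ, (v = 1 ∨ v = -1) → ∀ h > 0,
      legTime U c v h ≤ K * (1 + h) := fun c hc v hv h hh =>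
    (hbounds c hc v hv h hh).2.trans (by gcongr; exact le_max_left _ _)
  obtain ⟨d, hd0, hd⟩ : ∃ d > 0, d < min (δ / 2) (min (x₁ - x₀) (x₂ - x₁)) :=
    exists_between (lt_min (by linarith) (lt_min (by linarith) (by linarith)))
  rw [lt_min_iff, lt_min_iff] at hd
  obtain ⟨η, hη0, hη⟩ := exists_legTime_le hU hd0
  have hI := lintegral_expMeasure_one_pow_lt_top 4
  set I := ∫⁻ x, ENNReal.ofReal ((1 + |x|) ^ 4) ∂expMeasure 1
  -- Collects the factors of the integrand once it is bounded by a constant times `ε * (1 + |x|) ^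
  -- 4`.
  set C : ℝ := 3 * K * ((3 * K / κ + 1) * Real.exp 1) / η ^ 2
  have hC : 0 ≤ C := by positivity
  have hlim : Tendsto (fun ε : ℝ => C * I.toReal * ε) (𝓝[>] 0) (𝓝 0) := by
    have : Tendsto (fun ε : ℝ => C * I.toReal * ε) (𝓝 0) (𝓝 (C * I.toReal * 0)) :=
      tendsto_const_nhds.mul tendsto_id
    rw [mul_zero] at this
    exact this.mono_left nhdsWithin_le_nhds
  filter_upwards [hlim.eventually_lt_const (half_pos hδ), Ioc_mem_nhdsGT (zero_lt_one' ℝ)]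
    with ε hε1 hε s hs
  have hε0 := hε.1
  refine (lintegral_dist_bottom_le hU hε.1 hμ hκ hε.2 hgap hK (le_max_right _ _) hd.2.1 hd.2.2 hη
    hs).trans ?_
  have hbound : ∫⁻ x, (if η < ε * x then ENNReal.ofReal (3 * K * (1 + |x|)) else 0) *
      ENNReal.ofReal ((3 * K * (1 + |x|) / (κ * ε) + 1) * Real.exp 1) ∂expMeasure 1 ≤
      ENNReal.ofReal (C * ε) * I := by
    rw [← lintegral_const_mul _ (by fun_prop)]
    refine lintegral_mono fun x => ?_
    simp only
    split_ifs with h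
    · rw [← ENNReal.ofReal_mul (by positivity), ← ENNReal.ofReal_mul (by positivity)]
      refine ENNReal.ofReal_le_ofReal ?_
      -- The passage count costs a factor `1 / ε`. Bounding the indicator of `η < ε * x` by a square
      -- gains `ε ^ 2`, so one power of `ε` is left at the price of a fourth moment.
      have h1 : 1 ≤ (ε * (1 + |x|) / η) ^ 2 := by
        refine one_le_pow₀ ((one_le_div hη0).2 (h.le.trans ?_))
        gcongr
        linarith [le_abs_self x]
      have h2 : 3 * K * (1 + |x|) / (κ * ε) + 1 ≤ (3 * K / κ + 1) * (1 + |x|) / ε := by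
        have : 1 ≤ (1 + |x|) / ε := (one_le_div hε0).2 (by linarith [abs_nonneg x, hε.2])
        calc _ ≤ 3 * K * (1 + |x|) / (κ * ε) + (1 + |x|) / ε := by gcongr
          _ = _ := by field_simp
      calc 3 * K * (1 + |x|) * ((3 * K * (1 + |x|) / (κ * ε) + 1) * Real.exp 1)
          ≤ 3 * K * (1 + |x|) * (((3 * K / κ + 1) * (1 + |x|) / ε) * Real.exp 1) * 1 := by
            rw [mul_one]; gcongr
        _ ≤ 3 * K * (1 + |x|) * (((3 * K / κ + 1) * (1 + |x|) / ε) * Real.exp 1) *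
            (ε * (1 + |x|) / η) ^ 2 := by gcongr
        _ = C * ε * (1 + |x|) ^ 4 := by simp only [C]; field_simp
    · rw [zero_mul]; exact zero_le
  calc _ ≤ ENNReal.ofReal d + ENNReal.ofReal (C * ε) * I := add_le_add le_rfl hbound
    _ = ENNReal.ofReal (d + C * ε * I.toReal) := by
        rw [ENNReal.ofReal_add hd0.le (by positivity),
          ENNReal.ofReal_mul (p := C * ε) (by positivity),
          ENNReal.ofReal_toReal hI.ne]
    _ ≤ _ := ENNReal.ofReal_le_ofReal (by linarith [hd.1])

/-- The process is a function of its clocks alone, so everything can be computed on the sequence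
space under the joint law of the clocks, which is the infinite product law. -/
theorem isClockLaw_map {Ω : Type*} [MeasurableSpace Ω] {P : Measure Ω} [IsProbabilityMeasure P]
    {E : ℕ → Ω → ℝ} (hE_law : ∀ k, HasLaw (E k) (expMeasure 1) P) (hE_indep : iIndepFun E P) :
    AEMeasurable (fun ω k => E k ω) P ∧ IsClockLaw (P.map fun ω k => E k ω) := by
  have hm : AEMeasurable (fun ω k => E k ω) P :=
    aemeasurable_pi_lambda _ fun k => (hE_law k).aemeasurable
  refine ⟨hm, Measure.isProbabilityMeasure_map hm, fun k => ?_, ?_⟩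
  · rw [AEMeasurable.map_map_of_aemeasurable (measurable_pi_apply k).aemeasurable hm]
    exact (hE_law k).map_eq
  · rw [hE_indep.map_fun_eq_infinitePi_map₀ hm]
    simp_rw [(hE_law _).map_eq]
    exact iIndepFun_infinitePi (X := fun _ x => x) fun _ => measurable_id

end Metastability

end VelocityJump

/-! ### Return to the given probability space and conclusion -/

theorem mainTheorem8
    {Ω : Type*} [MeasurableSpace Ω] (P : Measure Ω) [IsProbabilityMeasure P]
    (E : ℕ → Ω → ℝ)
    (hE_law : ∀ k, HasLaw (E k) (expMeasure 1) P)
    (hE_indep : iIndepFun E P)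
    (U : ℝ → ℝ) (x₀ x₁ x₂ : ℝ)
    (hU : IsDoubleWell U x₀ x₁ x₂)
    (hlt : U x₂ < U x₀) :
    (∀ ε, 0 < ε → VelocityJump.meanHittingTime P E U ε x₀ (-1) x₁ < ⊤) ∧
    ∀ t : ℝ, 0 < t →
      Tendsto
        (fun ε : ℝ => wassersteinOne
          (VelocityJump.positionLaw P E U ε x₀ (-1)
            (t * (VelocityJump.meanHittingTime P E U ε x₀ (-1) x₁).toReal))
          (ENNReal.ofReal (Real.exp (-t)) • Measure.dirac x₀ +
            ENNReal.ofReal (1 - Real.exp (-t)) • Measure.dirac x₂))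
        (𝓝[>] 0) (𝓝 0) := by
  obtain ⟨hm, hμ⟩ := VelocityJump.isClockLaw_map hE_law hE_indep
  set μ := P.map fun ω k => E k ω
  have := hμ.isProb
  obtain ⟨κ, hκ, K, hK0, hbounds⟩ := VelocityJump.exists_legTime_bounds hU
  have hmean : ∀ ε, 0 < ε → VelocityJump.meanHittingTime P E U ε x₀ (-1) x₁ =
      ∫⁻ e, VelocityJump.hittingTime U ε x₀ (-1) e x₁ ∂μ := fun ε hε =>
    (lintegral_map' (VelocityJump.aemeasurable_hittingTime hU hε hμ) hm).symm
  refine ⟨fun ε hε => ?_, fun t ht => ?_⟩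
  · rw [hmean ε hε]
    have h := VelocityJump.lintegral_hittingTime hU
      (fun c hc v hv h hh => (hbounds c hc v hv h hh).2) hε hμ
    exact lt_of_le_of_lt (h ▸ le_self_add) ENNReal.ofReal_lt_top
  · set s : ℝ → ℝ := fun ε =>
      t * (∫⁻ e, VelocityJump.hittingTime U ε x₀ (-1) e x₁ ∂μ).toReal
    have hs0 : ∀ ε, 0 ≤ s ε := fun ε => mul_nonneg ht.le ENNReal.toReal_nonneg
    have hprob := VelocityJump.tendsto_measure_position_lt hU hlt hμ ht
    have herr : Tendsto (fun ε => ENNReal.ofReal (|x₂ - x₀| *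
        |μ.real {e | VelocityJump.position U ε x₀ (-1) e (s ε) < x₁} - Real.exp (-t)|))
        (𝓝[>] 0) (𝓝 0) := by
      have := ((hprob.sub_const (Real.exp (-t))).abs).const_mul |x₂ - x₀|
      rw [sub_self, abs_zero, mul_zero] at this
      simpa using ENNReal.tendsto_ofReal this
    have hdist : Tendsto (fun ε => ∫⁻ e, ENNReal.ofReal
        (if VelocityJump.position U ε x₀ (-1) e (s ε) < x₁ then
          |VelocityJump.position U ε x₀ (-1) e (s ε) - x₀| else
          |VelocityJump.position U ε x₀ (-1) e (s ε) - x₂|) ∂μ) (𝓝[>] 0) (𝓝 0) := by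
      rw [ENNReal.tendsto_nhds_zero]
      intro a ha
      obtain ⟨δ, hδ0, hδ⟩ := ENNReal.lt_iff_exists_real_btwn.1 ha
      have hδpos : 0 < δ := ENNReal.ofReal_pos.1 hδ.1
      filter_upwards [VelocityJump.eventually_lintegral_dist_bottom_le hU hμ hδpos] with ε hε
      exact (hε _ (hs0 ε)).trans hδ.2.le
    have hsum := hdist.add herr
    rw [add_zero] at hsum
    refine tendsto_of_tendsto_of_tendsto_of_le_of_le' tendsto_const_nhds hsum
      (Eventually.of_forall fun _ => zero_le) ?_
    filter_upwards [Ioc_mem_nhdsGT (zero_lt_one' ℝ)] with ε hε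
    have hX := VelocityJump.aemeasurable_position hU hε.1 hμ hκ hε.2
      (fun c hc v hv h hh => (hbounds c hc v hv h hh).1) (hs0 ε)
    have hlaw : VelocityJump.positionLaw P E U ε x₀ (-1)
        (t * (VelocityJump.meanHittingTime P E U ε x₀ (-1) x₁).toReal) =
        μ.map fun e => VelocityJump.position U ε x₀ (-1) e (s ε) := by
      rw [hmean ε hε.1, AEMeasurable.map_map_of_aemeasurable hX hm]
      rfl
    rw [hlaw]
    have := Measure.isProbabilityMeasure_map hX
    -- Splitting the line at `x₁` yields exactly the two quantities shown above to vanish: the mean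
    -- distance to the bottom and the error in the probability of being left of `x₁`.
    refine (wassersteinOne_two_points_le _ x₀ x₁ x₂ (Real.exp_pos _).le
      (Real.exp_le_one_iff.2 (by linarith))).trans (le_of_eq ?_)
    have hmeas : Measurable fun z : ℝ => ENNReal.ofReal (if z < x₁ then |z - x₀| else |z - x₂|) :=
      (Measurable.ite measurableSet_Iio (by fun_prop) (by fun_prop)).ennreal_ofReal
    rw [lintegral_map' hmeas.aemeasurable hX,
      map_measureReal_apply_of_aemeasurable hX measurableSet_Iio]
    rfl
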